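/- Let $V_1$ be the complex vector space of binary linear forms with the natural action of $SL_2=SL_2(\mathbb{C})$, and let $nV_1=V_1\oplus\cdots\oplus V_1$ ($n$ summands). Let $\mathcal{I}_n=\mathbb{C}[nV_1]^{SL_2}$ be the algebra of joint invariants of $n$ linear forms, graded by the usual degree, and let $\mathcal{C}_n=\mathbb{C}[nV_1\oplus\mathbb{C}^2]^{SL_2}$ be the algebra of joint covariants of $n$ linear forms, graded by the degree of covariants, i.e. the degree in the coefficients of the $n$ forms (the coordinates on $\mathbb{C}^2$ have weight $0$). For a finitely generated graded complex domain $R=R_0\oplus R_1\oplus\cdots$ with $R_0=\mathbb{C}$, let $\mathcal{P}(R,z)=\sum_{j\ge 0}\dim(R_j)\,z^j$ be its Poincaré series (a rational function of $z$), let $r$ be the transcendence degree over $\mathbb{C}$ of the field of fractions of $R$, and let $$\deg(R)=\lim_{z\to 1}(1-z)^r\,\mathcal{P}(R,z).$$ For $m\ge 1$ let $N_m(z)=\sum_{k=1}^{m}\frac1k\binom{m-1}{k-1}\binom{m}{k-1}z^{k-1}$ be the Narayana polynomial. Then the graded pieces of $\mathcal{I}_n$ and $\mathcal{C}_n$ are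 finite-dimensional, the limits below exist, and (i) $\displaystyle \deg(\mathcal{I}_n)=\frac{1}{(n-1)\,2^{2n-3}}\binom{2n-4}{n-2}$ for all $n\ge 2$, and $\displaystyle \deg(\mathcal{I}_n)=\frac{N_{n-2}(1)}{2^{2n-3}}=\frac{1}{(n-1)\,2^{2n-3}}\binom{2n-4}{n-2}$ for all $n\ge 3$; (ii) $\displaystyle \deg(\mathcal{C}_n)=\frac{1}{2^{2n-2}}\binom{2n-2}{n-1}$ for all $n\ge 1$. -/

import Mathlib

open Filter Topology

noncomputable section

/-- The natural action of `SL₂(ℂ)` on `n`-tuples of binary linear forms. The `i`-th form is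
`x ↦ a i 0 * x 0 + a i 1 * x 1`; acting by `g` means substituting `g⁻¹ x` for `x`. -/
def actForms {n : ℕ} (g : Matrix.SpecialLinearGroup (Fin 2) ℂ) (a : Fin n → Fin 2 → ℂ) :
    Fin n → Fin 2 → ℂ :=
  fun i => Matrix.vecMul (a i) ((g⁻¹ : Matrix.SpecialLinearGroup (Fin 2) ℂ) : Matrix (Fin 2) (Fin 2) ℂ)

/-- The natural action of `SL₂(ℂ)` on `ℂ²`. -/
def actVec (g : Matrix.SpecialLinearGroup (Fin 2) ℂ) (x : Fin 2 → ℂ) : Fin 2 → ℂ :=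
  Matrix.mulVec (g : Matrix (Fin 2) (Fin 2) ℂ) x

/-- The value of a polynomial function on `n V₁` at an `n`-tuple of linear forms. -/
def evalForms {n : ℕ} (a : Fin n → Fin 2 → ℂ) : MvPolynomial (Fin n × Fin 2) ℂ →ₐ[ℂ] ℂ :=
  MvPolynomial.aeval fun p => a p.1 p.2

/-- The value of a polynomial function on `n V₁ ⊕ ℂ²` at an `n`-tuple of linear forms and a
vector. -/
def evalFormsVec {n : ℕ} (a : Fin n → Fin 2 → ℂ) (x : Fin 2 → ℂ) :
    MvPolynomial ((Fin n × Fin 2) ⊕ Fin 2) ℂ →ₐ[ℂ] ℂ :=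
  MvPolynomial.aeval (Sum.elim (fun p => a p.1 p.2) x)

/-- The algebra `ℂ[n V₁]^{SL₂}` of joint invariants of `n` binary linear forms. -/
def jointInvariants (n : ℕ) : Subalgebra ℂ (MvPolynomial (Fin n × Fin 2) ℂ) where
  carrier := {F | ∀ (g : Matrix.SpecialLinearGroup (Fin 2) ℂ) (a : Fin n → Fin 2 → ℂ),
    evalForms (actForms g a) F = evalForms a F}
  mul_mem' := fun hF hG g a => by rw [map_mul, map_mul, hF g a, hG g a]
  add_mem' := fun hF hG g a => by rw [map_add, map_add, hF g a, hG g a]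
  algebraMap_mem' := fun c g a => by rw [AlgHom.commutes, AlgHom.commutes]

/-- The algebra `ℂ[n V₁ ⊕ ℂ²]^{SL₂}` of joint covariants of `n` binary linear forms. -/
def jointCovariants (n : ℕ) : Subalgebra ℂ (MvPolynomial ((Fin n × Fin 2) ⊕ Fin 2) ℂ) where
  carrier := {F | ∀ (g : Matrix.SpecialLinearGroup (Fin 2) ℂ) (a : Fin n → Fin 2 → ℂ)
    (x : Fin 2 → ℂ), evalFormsVec (actForms g a) (actVec g x) F = evalFormsVec a x F}
  mul_mem' := fun hF hG g a x => by rw [map_mul, map_mul, hF g a x, hG g a x]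
  add_mem' := fun hF hG g a x => by rw [map_add, map_add, hF g a x, hG g a x]
  algebraMap_mem' := fun c g a x => by rw [AlgHom.commutes, AlgHom.commutes]

/-- The joint invariants that are homogeneous of degree `j`. -/
def invariantsPiece (n j : ℕ) : Submodule ℂ (jointInvariants n) :=
  (MvPolynomial.homogeneousSubmodule (Fin n × Fin 2) ℂ j).comap (jointInvariants n).val.toLinearMap

/-- The joint covariants of degree `j`. As usual for covariants, the degree is the degree in the
coefficients of the `n` forms; the coordinates of the vector in `ℂ²` have weight `0` (the degree
in them is called the order of the covariant). -/
def covariantsPiece (n j : ℕ) : Submodule ℂ (jointCovariants n) :=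
  (MvPolynomial.weightedHomogeneousSubmodule ℂ
    (Sum.elim (fun _ : Fin n × Fin 2 => 1) (fun _ : Fin 2 => 0) : (Fin n × Fin 2) ⊕ Fin 2 → ℕ)
    j).comap (jointCovariants n).val.toLinearMap

/-- The Poincaré series `∑ⱼ dim Rⱼ zʲ` of a graded complex algebra with pieces `𝒜 j = Rⱼ`. -/
def poincareSeries {R : Type*} [CommRing R] [Algebra ℂ R] (𝒜 : ℕ → Submodule ℂ R) :
    PowerSeries ℂ :=
  PowerSeries.mk fun j => (Module.finrank ℂ (𝒜 j) : ℂ)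

/-- The number `d` is the degree `lim_{z → 1} (1 - z)^r P(R, z)` of the graded algebra `R`, `r`
being the transcendence degree over `ℂ` of the field of fractions of `R`. The graded pieces are
finite-dimensional, and the Poincaré series is (the expansion at `0` of) a rational function
`p / q`, which gives `P(R, z)` its meaning for `z` near `1`. -/
def HasDegree {R : Type*} [CommRing R] [IsDomain R] [Algebra ℂ R] (𝒜 : ℕ → Submodule ℂ R)
    (d : ℂ) : Prop :=
  (∀ j, Module.Finite ℂ (𝒜 j)) ∧
  ∃ r : ℕ, Algebra.trdeg ℂ (FractionRing R) = (r : Cardinal) ∧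
  ∃ p q : Polynomial ℂ, q ≠ 0 ∧ (q : PowerSeries ℂ) * poincareSeries 𝒜 = (p : PowerSeries ℂ) ∧
    Tendsto (fun z : ℂ => (1 - z) ^ r * (p.eval z / q.eval z)) (𝓝[≠] 1) (𝓝 d)

/-- The Narayana polynomial `N_m(z) = ∑_{k=1}^m (1/k) C(m-1,k-1) C(m,k-1) z^{k-1}`. -/
def narayana (m : ℕ) : Polynomial ℂ :=
  ∑ k ∈ Finset.Icc 1 m,
    Polynomial.C ((1 / (k : ℂ)) * ((m - 1).choose (k - 1) : ℂ) * (m.choose (k - 1) : ℂ)) *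
      Polynomial.X ^ (k - 1)

end

/-
`SL₂` is generated by transvections, so a polynomial is invariant exactly when it is killed by the
two polarization derivations, which span an action of `sl₂` together with their bracket. In a
finite-dimensional representation of `sl₂` the invariants have dimension `dim V₀ - dim V₂`, where
`V_w` is the weight space of weight `w`; for polynomials the weight spaces are spanned by monomials,
so the dimensions of the graded pieces are differences of numbers of monomials. The invariants of
degree `2k` of `m + 2` forms have dimension `C(k+m, m) C(k+m+1, m) / (m+1)`.

A covariant is an invariant of one more form, the vector being identified with a form by the
symplectic structure of `ℂ²`. The covariants of degree `j` and order at most `D` of `m + 1` forms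
have dimension `C(m + ⌊j/2⌋, m) C(m + ⌈j/2⌉, m)` for every `D ≥ j`; hence none has order above `j`.

All these dimensions are quasipolynomials in the degree, of period 2 and of degree one less than the
transcendence degree, for which the brackets of two chosen forms with all forms are a transcendence
basis. The leading coefficients of the quasipolynomial then give the limit at `z = 1`.
-/

open MvPolynomial
open scoped MatrixGroups

section Sl2

/-- Endomorphisms `h, e, f` satisfying the `sl₂` relations, that is, a representation of `sl₂`.
Unlike in `IsSl2Triple`, `h` may vanish, so that trivial representations are included. -/
structure IsSl2Rep {K V : Type*} [Field K] [AddCommGroup V] [Module K V]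
    (h e f : Module.End K V) : Prop where
  lie_e_f : ⁅e, f⁆ = h
  lie_h_e : ⁅h, e⁆ = (2 : K) • e
  lie_h_f : ⁅h, f⁆ = -((2 : K) • f)

namespace IsSl2Rep

variable {K V : Type*} [Field K] [AddCommGroup V] [Module K V] {h e f : Module.End K V}

theorem symm (t : IsSl2Rep h e f) : IsSl2Rep (-h) f e where
  lie_e_f := by rw [← t.lie_e_f, Ring.lie_def, Ring.lie_def, neg_sub]
  lie_h_e := by
    rw [← neg_neg ((2 : K) • f), ← t.lie_h_f, Ring.lie_def, Ring.lie_def, neg_mul, mul_neg]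
    abel
  lie_h_f := by
    rw [← t.lie_h_e, Ring.lie_def, Ring.lie_def, neg_mul, mul_neg]
    abel

theorem e_f_apply (t : IsSl2Rep h e f) (v : V) : e (f v) = f (e v) + h v := by
  rw [← t.lie_e_f, Ring.lie_def, LinearMap.sub_apply, Module.End.mul_apply, Module.End.mul_apply,
    add_sub_cancel]

theorem h_e_apply (t : IsSl2Rep h e f) (v : V) : h (e v) = e (h v) + (2 : K) • e v := by
  rw [← LinearMap.smul_apply, ← t.lie_h_e, Ring.lie_def, LinearMap.sub_apply,
    Module.End.mul_apply, Module.End.mul_apply, add_sub_cancel]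

theorem e_apply_mem_eigenspace (t : IsSl2Rep h e f) {μ : K} {v : V} (hv : v ∈ h.eigenspace μ) :
    e v ∈ h.eigenspace (μ + 2) := by
  rw [Module.End.mem_eigenspace_iff] at hv ⊢
  rw [t.h_e_apply, hv, map_smul, add_smul]

theorem f_apply_mem_eigenspace (t : IsSl2Rep h e f) {μ : K} {v : V} (hv : v ∈ h.eigenspace μ) :
    f v ∈ h.eigenspace (μ - 2) := by
  have hv' : v ∈ (-h).eigenspace (-μ) := by
    rw [Module.End.mem_eigenspace_iff] at hv ⊢
    rw [LinearMap.neg_apply, hv, neg_smul]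
  have := t.symm.e_apply_mem_eigenspace hv'
  rw [Module.End.mem_eigenspace_iff, LinearMap.neg_apply, neg_eq_iff_eq_neg] at this
  rw [Module.End.mem_eigenspace_iff, this, ← neg_smul]
  ring_nf

theorem e_pow_apply_mem_eigenspace (t : IsSl2Rep h e f) {μ : K} {v : V}
    (hv : v ∈ h.eigenspace μ) (n : ℕ) : (e ^ n) v ∈ h.eigenspace (μ + 2 * n) := by
  induction n with
  | zero => simpa using hv
  | succ n ih =>
    rw [pow_succ', Module.End.mul_apply]
    convert t.e_apply_mem_eigenspace ih using 2
    push_cast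
    ring

theorem e_pow_succ_f_apply (t : IsSl2Rep h e f) {μ : K} {v : V} (hv : v ∈ h.eigenspace μ)
    (n : ℕ) :
    (e ^ (n + 1)) (f v) = f ((e ^ (n + 1)) v) + ((n + 1) * (μ + n)) • (e ^ n) v := by
  induction n with
  | zero => simpa [Module.End.mem_eigenspace_iff.1 hv] using t.e_f_apply v
  | succ n ih =>
    have hweight := Module.End.mem_eigenspace_iff.1 (t.e_pow_apply_mem_eigenspace hv (n + 1))
    rw [pow_succ', Module.End.mul_apply, ih, map_add, map_smul, t.e_f_apply, hweight,
      ← Module.End.mul_apply e, ← pow_succ', ← Module.End.mul_apply e, ← pow_succ', add_assoc,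
      ← add_smul]
    congr 2
    push_cast
    ring

theorem restrict (t : IsSl2Rep h e f) {W : Submodule K V} (hh : ∀ v ∈ W, h v ∈ W)
    (he : ∀ v ∈ W, e v ∈ W) (hf : ∀ v ∈ W, f v ∈ W) :
    IsSl2Rep (h.restrict hh) (e.restrict he) (f.restrict hf) where
  lie_e_f := LinearMap.ext fun v => Subtype.ext (DFunLike.congr_fun t.lie_e_f (v : V))
  lie_h_e := LinearMap.ext fun v => Subtype.ext (DFunLike.congr_fun t.lie_h_e (v : V))
  lie_h_f := LinearMap.ext fun v => Subtype.ext (DFunLike.congr_fun t.lie_h_f (v : V))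

variable [CharZero K]

theorem two_add_natCast_ne_zero (n : ℕ) : (2 : K) + n ≠ 0 := by
  exact_mod_cast (by omega : 2 + n ≠ 0)

section FiniteDimensional

variable [FiniteDimensional K V]

theorem exists_e_pow_apply_eq_zero (t : IsSl2Rep h e f) {μ : K} {v : V}
    (hv : v ∈ h.eigenspace μ) : ∃ n : ℕ, (e ^ n) v = 0 := by
  by_contra! hne
  have heigen (n : ℕ) : h.HasEigenvalue (μ + 2 * n) :=
    Module.End.hasEigenvalue_of_hasEigenvector ⟨t.e_pow_apply_mem_eigenspace hv n, hne n⟩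
  have hinj : Function.Injective fun n : ℕ => μ + 2 * (n : K) := fun m n hmn => by simpa using hmn
  exact Set.infinite_of_injective_forall_mem hinj heigen h.finite_hasEigenvalue

theorem eq_zero_of_e_f_apply_eq_zero (t : IsSl2Rep h e f) {μ : K} (hμ : ∀ n : ℕ, μ + n ≠ 0)
    {v : V} (hv : v ∈ h.eigenspace μ) (hefv : e (f v) = 0) : v = 0 := by
  obtain ⟨n, hn⟩ := t.exists_e_pow_apply_eq_zero hv
  induction n with
  | zero => simpa using hn
  | succ n ih =>
    have hpow := t.e_pow_succ_f_apply hv n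
    rw [pow_succ, Module.End.mul_apply, hefv, map_zero, ← pow_succ, hn, map_zero, zero_add,
      eq_comm, smul_eq_zero] at hpow
    exact ih (hpow.resolve_left (mul_ne_zero n.cast_add_one_ne_zero (hμ n)))

theorem f_apply_eq_zero (t : IsSl2Rep h e f) {v : V} (hv : h v = 0) (hev : e v = 0) :
    f v = 0 := by
  refine t.symm.eq_zero_of_e_f_apply_eq_zero two_add_natCast_ne_zero ?_ ?_
  · have := t.f_apply_mem_eigenspace (μ := 0) (v := v) (by simpa using hv)
    rw [Module.End.mem_eigenspace_iff] at this ⊢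
    rw [LinearMap.neg_apply, this, ← neg_smul]
    ring_nf
  · rw [t.e_f_apply, hev, hv, map_zero, add_zero, map_zero]

theorem ker_e_inf_ker_f (t : IsSl2Rep h e f) :
    LinearMap.ker e ⊓ LinearMap.ker f = h.eigenspace 0 ⊓ LinearMap.ker e := by
  ext v
  simp only [Submodule.mem_inf, LinearMap.mem_ker, Module.End.mem_eigenspace_iff, zero_smul]
  constructor
  · rintro ⟨hev, hfv⟩
    have := t.e_f_apply v
    rw [hfv, hev, map_zero, map_zero, zero_add] at this
    exact ⟨this.symm, hev⟩
  · rintro ⟨hv, hev⟩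
    exact ⟨hev, t.f_apply_eq_zero hv hev⟩

theorem map_e_eigenspace_zero (t : IsSl2Rep h e f) :
    (h.eigenspace 0).map e = h.eigenspace 2 := by
  refine le_antisymm (Submodule.map_le_iff_le_comap.2 fun v hv => ?_) fun v hv => ?_
  · simpa using t.e_apply_mem_eigenspace hv
  have hf {w : V} (hw : w ∈ h.eigenspace 2) : f w ∈ h.eigenspace 0 := by
    simpa using t.f_apply_mem_eigenspace hw
  have hef (w : V) (hw : w ∈ h.eigenspace 2) : (e ∘ₗ f) w ∈ h.eigenspace 2 := by
    simpa using t.e_apply_mem_eigenspace (hf hw)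
  have hinj : Function.Injective ((e ∘ₗ f).restrict hef) := by
    refine (injective_iff_map_eq_zero _).2 fun w hw => Subtype.ext ?_
    exact t.eq_zero_of_e_f_apply_eq_zero two_add_natCast_ne_zero w.2 (congrArg Subtype.val hw)
  obtain ⟨w, hw⟩ := LinearMap.surjective_of_injective hinj ⟨v, hv⟩
  exact ⟨f w, hf w.2, congrArg Subtype.val hw⟩

theorem finrank_ker_inf_ker_add_finrank_eigenspace (t : IsSl2Rep h e f) :
    Module.finrank K (LinearMap.ker e ⊓ LinearMap.ker f : Submodule K V) +
      Module.finrank K (h.eigenspace 2) = Module.finrank K (h.eigenspace 0) := by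
  have hker := (e.domRestrict (h.eigenspace 0)).finrank_range_add_finrank_ker
  rw [LinearMap.range_domRestrict, t.map_e_eigenspace_zero, LinearMap.ker_domRestrict,
    ← Submodule.finrank_map_subtype_eq (h.eigenspace 0), Submodule.map_comap_subtype,
    ← t.ker_e_inf_ker_f, add_comm] at hker
  exact hker

end FiniteDimensional

theorem finrank_inf_ker_inf_ker_add_finrank_inf_eigenspace (t : IsSl2Rep h e f)
    (W : Submodule K V) [FiniteDimensional K W] (hh : ∀ v ∈ W, h v ∈ W)
    (he : ∀ v ∈ W, e v ∈ W) (hf : ∀ v ∈ W, f v ∈ W) :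
    Module.finrank K (W ⊓ (LinearMap.ker e ⊓ LinearMap.ker f) : Submodule K V) +
      Module.finrank K (W ⊓ h.eigenspace 2 : Submodule K V) =
        Module.finrank K (W ⊓ h.eigenspace 0 : Submodule K V) := by
  have hcomap (μ : K) :
      Module.End.eigenspace (h.restrict hh) μ = (h.eigenspace μ).comap W.subtype := by
    ext v
    simp [Subtype.ext_iff]
  have := (t.restrict hh he hf).finrank_ker_inf_ker_add_finrank_eigenspace
  rw [LinearMap.ker_restrict, LinearMap.ker_restrict, ← Submodule.comap_inf, hcomap, hcomap] at this
  simp only [← Submodule.finrank_map_subtype_eq W] at this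
  rwa [Submodule.map_comap_subtype, Submodule.map_comap_subtype,
    Submodule.map_comap_subtype] at this

end IsSl2Rep

end Sl2

section Polarization

/-- The polarization derivation of `R[x_{p,k}]` that replaces one variable `x_{p,j}` by `x_{p,i}`:
the action of the matrix unit `E_{ij}` on functions of a family, indexed by `ι`, of linear forms in
variables indexed by `κ`. -/
noncomputable def polarization (R ι : Type*) {κ : Type*} [CommRing R] [DecidableEq κ] (i j : κ) :
    Derivation R (MvPolynomial (ι × κ) R) (MvPolynomial (ι × κ) R) :=
  mkDerivation R fun p => if p.2 = j then X (p.1, i) else 0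

/-- The degrees of a monomial in each of the linear forms. -/
def multidegree {ι κ : Type*} [Fintype κ] (m : ι × κ →₀ ℕ) (p : ι) : ℕ := ∑ k, m (p, k)

/-- The degrees of a monomial in the `k`-th coefficients of the linear forms, for each `k`. These
are its weights under the diagonal torus. -/
def colDegree {ι κ : Type*} [Fintype ι] (m : ι × κ →₀ ℕ) (k : κ) : ℕ := ∑ p, m (p, k)

theorem multidegree_add {ι κ : Type*} [Fintype κ] (m m' : ι × κ →₀ ℕ) :
    multidegree (m + m') = multidegree m + multidegree m' :=
  funext fun _ => Finset.sum_add_distrib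

theorem multidegree_single {ι κ : Type*} [Fintype κ] [DecidableEq ι] (p : ι) (k : κ) (n : ℕ) :
    multidegree (Finsupp.single (p, k) n) = Pi.single p n := by
  classical
  ext q
  simp [multidegree, Finsupp.single_apply, Pi.single_apply, Prod.ext_iff, ite_and, eq_comm]

theorem colDegree_add {ι κ : Type*} [Fintype ι] (m m' : ι × κ →₀ ℕ) :
    colDegree (m + m') = colDegree m + colDegree m' :=
  _root_.funext fun _ => Finset.sum_add_distrib

theorem colDegree_single {ι κ : Type*} [Fintype ι] [DecidableEq κ] (p : ι) (k : κ) (n : ℕ) :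
    colDegree (Finsupp.single (p, k) n) = Pi.single k n := by
  classical
  ext l
  simp [colDegree, Finsupp.single_apply, Pi.single_apply, Prod.ext_iff, ite_and, eq_comm]

section Derivation

variable {R ι κ : Type*} [CommRing R] [DecidableEq κ]

theorem polarization_X (i j : κ) (p : ι × κ) :
    polarization R ι i j (X p) = if p.2 = j then X (p.1, i) else 0 :=
  mkDerivation_X _ _ _

theorem lie_polarization_polarization (i j k l : κ) :
    ⁅polarization R ι i j, polarization R ι k l⁆ =
      (if j = k then polarization R ι i l else 0) - if l = i then polarization R ι k j else 0 := by
  refine derivation_ext fun p => ?_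
  rw [Derivation.commutator_apply, Derivation.sub_apply]
  split_ifs <;> simp only [polarization_X, apply_ite (polarization R ι _ _), map_zero,
    Derivation.zero_apply] <;> grind

theorem polarization_map {S : Type*} [CommRing S] (φ : R →+* S) (i j : κ)
    (F : MvPolynomial (ι × κ) R) :
    polarization S ι i j (map φ F) = map φ (polarization R ι i j F) := by
  induction F using MvPolynomial.induction_on with
  | C r => simp
  | add F G hF hG => simp [hF, hG]
  | mul_X F p hF =>
    simp only [map_mul, map_X, Derivation.leibniz, smul_eq_mul, map_add, hF, polarization_X]
    split_ifs <;> simp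

theorem polarization_mem_restrictSupport_multidegree [Fintype κ] (i j : κ) {𝒢 : Set (ι → ℕ)}
    {F : MvPolynomial (ι × κ) R} (hF : F ∈ restrictSupport R {m | multidegree m ∈ 𝒢}) :
    polarization R ι i j F ∈ restrictSupport R {m | multidegree m ∈ 𝒢} := by
  classical
  rw [F.as_sum, map_sum]
  refine Submodule.sum_mem _ fun m hm => ?_
  rw [polarization, mkDerivation_monomial]
  refine Submodule.smul_mem _ _ (Submodule.sum_mem _ fun ⟨p, k⟩ hp => ?_)
  dsimp only
  split_ifs with hk
  · subst hk
    have hle : Finsupp.single (p, k) 1 ≤ m :=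
      Finsupp.single_le_iff.2 (Nat.one_le_iff_ne_zero.2 (Finsupp.mem_support_iff.1 hp))
    have hdeg : multidegree (m - Finsupp.single (p, k) 1 + Finsupp.single (p, i) 1) =
        multidegree m := by
      rw [multidegree_add, multidegree_single, ← multidegree_single p k, ← multidegree_add,
        tsub_add_cancel_of_le hle]
    rw [smul_eq_mul, X, monomial_mul, monomial_mem_restrictSupport]
    left
    rw [Set.mem_ofPred_eq, hdeg]
    exact (mem_restrictSupport_iff R).1 hF hm
  · rw [smul_zero]
    exact zero_mem _

theorem polarization_self_monomial [Fintype ι] [Finite κ] (k : κ) (m : ι × κ →₀ ℕ) (r : R) :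
    polarization R ι k k (monomial m r) = (colDegree m k : R) • monomial m r := by
  have := Fintype.ofFinite κ
  have hterm (p : ι × κ) :
      monomial (m - Finsupp.single p 1) (m p : R) * X p = (m p : R) • monomial m (1 : R) := by
    rw [X, monomial_mul, mul_one, smul_monomial, smul_eq_mul, mul_one]
    by_cases hp : m p = 0
    · simp [hp]
    · rw [tsub_add_cancel_of_le (Finsupp.single_le_iff.2 (Nat.one_le_iff_ne_zero.2 hp))]
  rw [polarization, mkDerivation_monomial, Finsupp.sum_fintype _ _ (by simp)]
  simp only [smul_eq_mul, mul_ite, mul_zero, Fintype.sum_prod_type, Finset.sum_ite_eq',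
    Finset.mem_univ, if_true]
  rw [Fintype.sum_congr _ _ fun p => hterm (p, k), ← Finset.sum_smul, smul_comm, smul_monomial,
    smul_eq_mul, mul_one, colDegree, Nat.cast_sum]

theorem coeff_polarization_self [Fintype ι] [Finite κ] (k : κ) (F : MvPolynomial (ι × κ) R)
    (m : ι × κ →₀ ℕ) :
    coeff m (polarization R ι k k F) = colDegree m k * coeff m F := by
  classical
  induction F using MvPolynomial.induction_on' with
  | monomial m' r =>
    rw [polarization_self_monomial, coeff_smul, coeff_monomial, smul_eq_mul]
    split_ifs with h
    · rw [h]
    · rw [mul_zero, mul_zero]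
  | add F G hF hG => rw [map_add, coeff_add, coeff_add, hF, hG, mul_add]

end Derivation

section Sl2

variable {K ι : Type*} [Field K]

/-- The action of the diagonal matrix `diag(1, -1)` on functions of a family of binary forms. -/
noncomputable def weightDerivation (K ι : Type*) [Field K] :
    Derivation K (MvPolynomial (ι × Fin 2) K) (MvPolynomial (ι × Fin 2) K) :=
  polarization K ι 0 0 - polarization K ι 1 1

theorem lie_weightDerivation (i j : Fin 2) :
    ⁅weightDerivation K ι, polarization K ι i j⁆ =
      ⁅polarization K ι (0 : Fin 2) 0, polarization K ι i j⁆ -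
        ⁅polarization K ι (1 : Fin 2) 1, polarization K ι i j⁆ := by
  ext1 F
  simp only [weightDerivation, Derivation.commutator_apply, Derivation.sub_apply, map_sub]
  abel

theorem isSl2Rep_polarization :
    IsSl2Rep (weightDerivation K ι).toLinearMap (polarization K ι 0 1).toLinearMap
      (polarization K ι 1 0).toLinearMap where
  lie_e_f := by
    rw [← Derivation.commutator_coe_linear_map, lie_polarization_polarization]
    rfl
  lie_h_e := by
    rw [← Derivation.commutator_coe_linear_map, lie_weightDerivation,
      lie_polarization_polarization, lie_polarization_polarization, two_smul]
    simp
  lie_h_f := by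
    rw [← Derivation.commutator_coe_linear_map, lie_weightDerivation,
      lie_polarization_polarization, lie_polarization_polarization, two_smul]
    simp [sub_eq_add_neg]

theorem eigenspace_weightDerivation [CharZero K] [Fintype ι] (w : ℕ) :
    Module.End.eigenspace (weightDerivation K ι).toLinearMap w =
      restrictSupport K {m | colDegree m 0 = colDegree m 1 + w} := by
  ext F
  rw [Module.End.mem_eigenspace_iff, mem_restrictSupport_iff, MvPolynomial.ext_iff]
  have hcast (m : ι × Fin 2 →₀ ℕ) : colDegree m 0 = colDegree m 1 + w ↔
      (colDegree m 0 : K) - colDegree m 1 = w := by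
    rw [sub_eq_iff_eq_add']
    exact_mod_cast Iff.rfl
  have hcoeff (m : ι × Fin 2 →₀ ℕ) : coeff m (weightDerivation K ι F) = coeff m ((w : K) • F) ↔
      coeff m F = 0 ∨ colDegree m 0 = colDegree m 1 + w := by
    rw [hcast, weightDerivation, Derivation.sub_apply, coeff_sub, coeff_polarization_self,
      coeff_polarization_self, coeff_smul, smul_eq_mul, ← sub_mul, mul_eq_mul_right_iff, or_comm]
  simp only [Derivation.coeFn_coe, hcoeff, or_iff_not_imp_left, ← mem_support_iff]
  rfl

end Sl2

end Polarization

section EvalMatrix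

variable {R A ι κ : Type*} [CommRing R] [CommRing A] [Algebra R A]

/-- The value of a polynomial at the family of linear forms whose coefficients are the rows of a
matrix. -/
noncomputable def evalMatrix (a : Matrix ι κ A) : MvPolynomial (ι × κ) R →ₐ[R] A :=
  aeval fun p => a p.1 p.2

theorem evalMatrix_X (a : Matrix ι κ A) (p : ι × κ) :
    evalMatrix a (X p : MvPolynomial (ι × κ) R) = a p.1 p.2 :=
  aeval_X _ _

theorem evalMatrix_map_algebraMap (a : Matrix ι κ A) (F : MvPolynomial (ι × κ) R) :
    evalMatrix a (map (algebraMap R A) F) = evalMatrix a F :=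
  aeval_map_algebraMap _ _ _

theorem eq_of_forall_evalMatrix_eq [IsDomain R] [Infinite R] {F G : MvPolynomial (ι × κ) R}
    (h : ∀ a : Matrix ι κ R, evalMatrix a F = evalMatrix a G) : F = G :=
  MvPolynomial.funext fun x => h (Matrix.of fun p k => x (p, k))

end EvalMatrix

section GroupAction

/-- The polynomials annihilated by the polarizations with `i ≠ j`, that is, the invariants of the
Lie algebra `sl_κ`. -/
noncomputable def polarInvariants (R ι κ : Type*) [CommRing R] [DecidableEq κ] :
    Subalgebra R (MvPolynomial (ι × κ) R) where
  carrier := {F | ∀ i j, i ≠ j → polarization R ι i j F = 0}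
  mul_mem' := fun hF hG i j hij => by
    rw [Derivation.leibniz, hF i j hij, hG i j hij, smul_zero, smul_zero, add_zero]
  add_mem' := fun hF hG i j hij => by rw [map_add, hF i j hij, hG i j hij, add_zero]
  algebraMap_mem' := fun c _ _ _ => Derivation.map_algebraMap _ c

section Shear

variable {R ι κ : Type*} [CommRing R] [DecidableEq κ]

theorem map_mem_polarInvariants {S : Type*} [CommRing S] (φ : R →+* S)
    {F : MvPolynomial (ι × κ) R} (hF : F ∈ polarInvariants R ι κ) :
    map φ F ∈ polarInvariants S ι κ := fun i j hij => by
  rw [polarization_map, hF i j hij, map_zero]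

/-- The restriction of a polynomial to the line `t ↦ a * transvection i j t` through the family
`a` of linear forms. -/
noncomputable def shearLine (i j : κ) (a : Matrix ι κ R) :
    MvPolynomial (ι × κ) R →ₐ[R] Polynomial R :=
  aeval fun p => Polynomial.C (a p.1 p.2) +
    if p.2 = j then Polynomial.X * Polynomial.C (a p.1 i) else 0

theorem derivative_shearLine {i j : κ} (hij : i ≠ j) (a : Matrix ι κ R)
    (F : MvPolynomial (ι × κ) R) :
    Polynomial.derivative (shearLine i j a F) = shearLine i j a (polarization R ι i j F) := by
  induction F using MvPolynomial.induction_on with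
  | C r => simp [shearLine]
  | add F G hF hG => simp [hF, hG]
  | mul_X F p hF =>
    have hX : Polynomial.derivative (shearLine i j a (X p)) =
        shearLine i j a (polarization R ι i j (X p)) := by
      rw [polarization_X]
      split_ifs with h <;> simp [shearLine, h, hij]
    rw [map_mul, Polynomial.derivative_mul, hF, hX, Derivation.leibniz, map_add, smul_eq_mul,
      smul_eq_mul, map_mul, map_mul]
    ring

theorem eval_shearLine [Fintype κ] (i j : κ) (a : Matrix ι κ R) (t : R)
    (F : MvPolynomial (ι × κ) R) :
    (shearLine i j a F).eval t = evalMatrix (a * Matrix.transvection i j t) F := by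
  have hcomp : (Polynomial.aeval t).comp (shearLine i j a) =
      evalMatrix (R := R) (a * Matrix.transvection i j t) := by
    refine algHom_ext fun p => ?_
    rw [AlgHom.comp_apply, shearLine, aeval_X, evalMatrix_X, Matrix.transvection, Matrix.mul_add,
      Matrix.mul_one, Matrix.add_apply]
    split_ifs with h <;> simp [h]
  rw [← hcomp, AlgHom.comp_apply, Polynomial.coe_aeval_eq_eval]

theorem polarization_eq_zero_iff [IsDomain R] [CharZero R] [Fintype κ] {i j : κ} (hij : i ≠ j)
    (F : MvPolynomial (ι × κ) R) :
    polarization R ι i j F = 0 ↔ ∀ (t : R) (a : Matrix ι κ R),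
      evalMatrix (a * Matrix.transvection i j t) F = evalMatrix a F := by
  have heval_zero (a : Matrix ι κ R) (G : MvPolynomial (ι × κ) R) :
      (shearLine i j a G).eval 0 = evalMatrix a G := by
    rw [eval_shearLine, Matrix.transvection_zero, Matrix.mul_one]
  constructor
  · intro h t a
    have hderiv := derivative_shearLine hij a F
    rw [h, map_zero] at hderiv
    rw [← eval_shearLine, ← heval_zero, Polynomial.eq_C_of_derivative_eq_zero hderiv,
      Polynomial.eval_C, Polynomial.eval_C]
  · intro h
    refine eq_of_forall_evalMatrix_eq fun a => ?_
    have hconst : shearLine i j a F = Polynomial.C (evalMatrix a F) :=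
      Polynomial.funext fun t => by rw [eval_shearLine, h, Polynomial.eval_C]
    rw [map_zero, ← heval_zero, ← derivative_shearLine hij, hconst, Polynomial.derivative_C,
      Polynomial.eval_zero]

end Shear

theorem mem_polarInvariants_fin_two_iff {K ι : Type*} [Field K] [CharZero K]
    (F : MvPolynomial (ι × Fin 2) K) :
    F ∈ polarInvariants K ι (Fin 2) ↔ ∀ (g : SL(2, K)) (a : Matrix ι (Fin 2) K),
      evalMatrix (a * (g : Matrix (Fin 2) (Fin 2) K)) F = evalMatrix a F := by
  constructor
  · intro h g
    induction g using Matrix.SL2.transvection_induction with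
    | htransvec i j hij t => exact (polarization_eq_zero_iff hij F).1 (h i j hij) t
    | hmul g g' hg hg' =>
      intro a
      rw [Matrix.SpecialLinearGroup.coe_mul, ← Matrix.mul_assoc, hg', hg]
  · intro h i j hij
    exact (polarization_eq_zero_iff hij F).2 fun t =>
      h (Matrix.SpecialLinearGroup.transvection hij t)

theorem jointInvariants_eq_polarInvariants (n : ℕ) :
    jointInvariants n = polarInvariants ℂ (Fin n) (Fin 2) := by
  ext F
  rw [mem_polarInvariants_fin_two_iff]
  exact ⟨fun h g => by rw [← inv_inv g]; exact h g⁻¹, fun h g => h g⁻¹⟩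

end GroupAction

section TranscendenceDegree

theorem isTranscendenceBasis_of_mem_adjoin_range {K A L σ : Type*} [Field K]
    [CommRing A] [Algebra K A] [Field L] [Algebra K L] {f : A →ₐ[K] L}
    (hf : Function.Injective f) {x : σ → A} (hx : AlgebraicIndependent K x)
    (hmem : ∀ a, f a ∈ IntermediateField.adjoin K (Set.range (f ∘ x))) :
    IsTranscendenceBasis K x := by
  have : IsDomain A := hf.isDomain f.toRingHom
  refine hx.isTranscendenceBasis_iff_isAlgebraic.2 ⟨fun a => ?_⟩
  have halg (p : MvPolynomial σ K) : IsAlgebraic (Algebra.adjoin K (Set.range x)) (aeval x p) :=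
    isAlgebraic_algebraMap (⟨aeval x p, by
      rw [Algebra.adjoin_range_eq_range_aeval]; exact ⟨p, rfl⟩⟩ : Algebra.adjoin K (Set.range x))
  obtain ⟨r, s, hrs⟩ := (IntermediateField.mem_adjoin_range_iff _ _ _).1 (hmem a)
  have hcomp (p : MvPolynomial σ K) : aeval (f ∘ x) p = f (aeval x p) := by
    rw [← AlgHom.comp_apply, comp_aeval]
    rfl
  rw [hcomp, hcomp] at hrs
  by_cases hs : aeval x s = 0
  · rw [hs, map_zero, div_zero, map_eq_zero_iff f hf] at hrs
    exact hrs ▸ isAlgebraic_zero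
  · refine (halg s).of_mul (mem_nonZeroDivisors_of_ne_zero hs) ?_
    have : aeval x s * a = aeval x r := hf <| by
      rw [map_mul, hrs, mul_div_cancel₀ _ ((map_ne_zero_iff f hf).2 hs)]
    exact this ▸ halg r

variable {R ι : Type*} [CommRing R]

/-- The bracket, or `2 × 2` determinant, of two linear forms. -/
noncomputable def bracket (R : Type*) {ι : Type*} [CommRing R] (i j : ι) :
    polarInvariants R ι (Fin 2) :=
  ⟨X (i, 0) * X (j, 1) - X (i, 1) * X (j, 0), fun k l hkl => by
    rw [map_sub, Derivation.leibniz, Derivation.leibniz]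
    simp only [polarization_X]
    fin_cases k <;> fin_cases l <;> simp at hkl ⊢ <;> ring⟩

theorem evalMatrix_bracket {A : Type*} [CommRing A] [Algebra R A] (a : Matrix ι (Fin 2) A)
    (i j : ι) : evalMatrix a (bracket R i j).1 = a i 0 * a j 1 - a i 1 * a j 0 := by
  simp [bracket, evalMatrix_X]

/-- The brackets of the forms `u` and `v` with each other and with the remaining forms, which turn
out to be a transcendence basis of the algebra of invariants. -/
noncomputable def bracketBasis (R : Type*) {ι : Type*} [CommRing R] (u v : ι) :
    Option (Fin 2 × ({u, v}ᶜ : Set ι)) → polarInvariants R ι (Fin 2)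
  | none => bracket R u v
  | some (k, i) => bracket R (![u, v] k) i

section NormalForm

variable {L : Type*} [Field L] [DecidableEq ι] {u v : ι}

/-- The family of binary forms with prescribed values `c` of the brackets in `bracketBasis` whose
form `u` is the first coordinate and whose form `v` is a multiple of the second one. -/
def normalForm (c : Option (Fin 2 × ({u, v}ᶜ : Set ι)) → L) : Matrix ι (Fin 2) L := fun i =>
  if hu : i = u then ![1, 0]
  else if hv : i = v then ![0, c none]
  else ![-c (some (1, ⟨i, by simp [hu, hv]⟩)) / c none, c (some (0, ⟨i, by simp [hu, hv]⟩))]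

theorem normalForm_left (c : Option (Fin 2 × ({u, v}ᶜ : Set ι)) → L) :
    normalForm c u = ![1, 0] :=
  dif_pos rfl

theorem normalForm_right (huv : u ≠ v) (c : Option (Fin 2 × ({u, v}ᶜ : Set ι)) → L) :
    normalForm c v = ![0, c none] :=
  (dif_neg huv.symm).trans (dif_pos rfl)

theorem normalForm_other (c : Option (Fin 2 × ({u, v}ᶜ : Set ι)) → L)
    (i : ({u, v}ᶜ : Set ι)) :
    normalForm c i = ![-c (some (1, i)) / c none, c (some (0, i))] :=
  (dif_neg fun h => i.2 (.inl h)).trans (dif_neg fun h => i.2 (.inr h))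

theorem evalMatrix_normalForm_bracketBasis [Algebra R L] (huv : u ≠ v)
    {c : Option (Fin 2 × ({u, v}ᶜ : Set ι)) → L} (hc : c none ≠ 0)
    (s : Option (Fin 2 × ({u, v}ᶜ : Set ι))) :
    evalMatrix (normalForm c) (bracketBasis R u v s).1 = c s := by
  obtain _ | ⟨k, i⟩ := s
  · simp [bracketBasis, evalMatrix_bracket, normalForm_left, normalForm_right huv]
  · fin_cases k
    · simp [bracketBasis, evalMatrix_bracket, normalForm_left, normalForm_other]
    · simp [bracketBasis, evalMatrix_bracket, normalForm_right huv, normalForm_other]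
      field_simp

theorem exists_mul_eq_normalForm [Algebra R L] (huv : u ≠ v) {a : Matrix ι (Fin 2) L}
    (ha : evalMatrix a (bracket R u v).1 ≠ 0) :
    ∃ g : Matrix.SpecialLinearGroup (Fin 2) L, a * (g : Matrix (Fin 2) (Fin 2) L) =
      normalForm fun s => evalMatrix a (bracketBasis R u v s).1 := by
  obtain ⟨b, hb⟩ : ∃ b, b = evalMatrix a (bracket R u v).1 := ⟨_, rfl⟩
  rw [← hb] at ha
  refine ⟨⟨!![a v 1 / b, -a u 1; -a v 0 / b, a u 0], ?_⟩, ?_⟩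
  · rw [Matrix.det_fin_two_of]
    field_simp
    rw [hb, evalMatrix_bracket]
    ring
  · have hmul (i : ι) : (a * !![a v 1 / b, -a u 1; -a v 0 / b, a u 0]) i =
        ![evalMatrix a (bracket R i v).1 / b, evalMatrix a (bracket R u i).1] := by
      ext k
      rw [Matrix.mul_apply, Fin.sum_univ_two, evalMatrix_bracket, evalMatrix_bracket]
      fin_cases k <;> simp <;> ring
    refine _root_.funext fun i => (hmul i).trans ?_
    rcases eq_or_ne i u with rfl | hu
    · rw [normalForm_left, ← hb, div_self ha]
      simp [evalMatrix_bracket, mul_comm]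
    rcases eq_or_ne i v with rfl | hv
    · simp [normalForm_right huv, evalMatrix_bracket, bracketBasis, mul_comm]
    · rw [normalForm_other _ ⟨i, by simp [hu, hv]⟩]
      have hswap : evalMatrix a (bracket R i v).1 = -evalMatrix a (bracket R v i).1 := by
        simp [evalMatrix_bracket, mul_comm]
      simp [bracketBasis, ← hb, hswap]

theorem evalMatrix_normalForm_mem_adjoin {K : Type*} [Field K] [Algebra K L]
    (c : Option (Fin 2 × ({u, v}ᶜ : Set ι)) → L) (F : MvPolynomial (ι × Fin 2) K) :
    evalMatrix (normalForm c) F ∈ IntermediateField.adjoin K (Set.range c) := by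
  have hc (s) : c s ∈ IntermediateField.adjoin K (Set.range c) :=
    IntermediateField.subset_adjoin _ _ ⟨s, rfl⟩
  have hentries : Set.range (fun p : ι × Fin 2 => normalForm c p.1 p.2) ⊆
      IntermediateField.adjoin K (Set.range c) := by
    rintro _ ⟨⟨i, k⟩, rfl⟩
    dsimp only [normalForm]
    split_ifs <;> fin_cases k <;> simp [hc, zero_mem, one_mem, div_mem]
  exact Algebra.adjoin_le (S := (IntermediateField.adjoin K (Set.range c)).toSubalgebra) hentries
    (Algebra.adjoin_range_eq_range_aeval K (fun p : ι × Fin 2 => normalForm c p.1 p.2) ▸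
      ⟨F, rfl⟩)

end NormalForm

theorem algebraicIndependent_bracketBasis {K : Type*} [Field K] {u v : ι} (huv : u ≠ v) :
    AlgebraicIndependent K (bracketBasis K u v) := by
  classical
  let L := FractionRing (MvPolynomial (Option (Fin 2 × ({u, v}ᶜ : Set ι))) K)
  let c (s : Option (Fin 2 × ({u, v}ᶜ : Set ι))) : L := algebraMap (MvPolynomial _ K) L (X s)
  have hc : AlgebraicIndependent K c :=
    (algebraicIndependent_X _ K).map' (f := IsScalarTower.toAlgHom K _ L)
      (IsFractionRing.injective _ _)
  refine .of_comp ((evalMatrix (normalForm c)).comp (polarInvariants K ι (Fin 2)).val) ?_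
  convert hc using 1
  exact _root_.funext fun s => evalMatrix_normalForm_bracketBasis huv (hc.ne_zero none) s

theorem evalMatrix_mem_adjoin_bracketBasis {K L : Type*} [Field K] [CharZero K] [Field L]
    [Algebra K L] {u v : ι} (huv : u ≠ v) {a : Matrix ι (Fin 2) L}
    (ha : evalMatrix a (bracket K u v).1 ≠ 0) (F : polarInvariants K ι (Fin 2)) :
    evalMatrix a F.1 ∈
      IntermediateField.adjoin K (Set.range fun s => evalMatrix a (bracketBasis K u v s).1) := by
  classical
  have : CharZero L := charZero_of_injective_algebraMap (algebraMap K L).injective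
  obtain ⟨g, hg⟩ := exists_mul_eq_normalForm huv ha
  have hF : evalMatrix a F.1 = evalMatrix (a * (g : Matrix (Fin 2) (Fin 2) L)) F.1 := by
    rw [← evalMatrix_map_algebraMap a, ← evalMatrix_map_algebraMap (a * _)]
    exact ((mem_polarInvariants_fin_two_iff _).1 (map_mem_polarInvariants _ F.2) g a).symm
  rw [hF, hg]
  exact evalMatrix_normalForm_mem_adjoin _ _

theorem isTranscendenceBasis_bracketBasis {K : Type*} [Field K] [CharZero K] {u v : ι}
    (huv : u ≠ v) : IsTranscendenceBasis K (bracketBasis K u v) := by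
  let L := FractionRing (MvPolynomial (ι × Fin 2) K)
  let a : Matrix ι (Fin 2) L := fun i k => algebraMap (MvPolynomial _ K) L (X (i, k))
  have heval : evalMatrix a = IsScalarTower.toAlgHom K (MvPolynomial (ι × Fin 2) K) L :=
    algHom_ext fun p => evalMatrix_X a p
  have hinj : Function.Injective ((evalMatrix a).comp (polarInvariants K ι (Fin 2)).val) := by
    rw [heval]
    exact (IsFractionRing.injective (MvPolynomial (ι × Fin 2) K) L).comp Subtype.val_injective
  have hbasis := algebraicIndependent_bracketBasis (K := K) huv
  have hbracket : evalMatrix a (bracket K u v).1 ≠ 0 := fun h =>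
    hbasis.ne_zero none (hinj (h.trans (map_zero _).symm))
  exact isTranscendenceBasis_of_mem_adjoin_range hinj hbasis fun F =>
    evalMatrix_mem_adjoin_bracketBasis huv hbracket F

theorem trdeg_polarInvariants {K : Type*} [Field K] [CharZero K] [Fintype ι]
    (hι : 2 ≤ Fintype.card ι) :
    Algebra.trdeg K (polarInvariants K ι (Fin 2)) = (2 * Fintype.card ι - 3 : ℕ) := by
  classical
  obtain ⟨u, v, huv⟩ := Fintype.one_lt_card_iff.1 hι
  have hcard : Fintype.card (Option (Fin 2 × ({u, v}ᶜ : Set ι))) = 2 * Fintype.card ι - 3 := by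
    have huv_card : Fintype.card ({u, v} : Set ι) = 2 := by
      rw [← Nat.card_eq_fintype_card, Nat.card_coe_set_eq, Set.ncard_pair huv]
    rw [Fintype.card_option, Fintype.card_prod, Fintype.card_fin, Fintype.card_compl_set, huv_card]
    omega
  have htrdeg := (isTranscendenceBasis_bracketBasis (K := K) huv).lift_cardinalMk_eq_trdeg
  rw [Cardinal.mk_fintype, hcard, Cardinal.lift_natCast] at htrdeg
  exact Cardinal.lift_injective (by rw [← htrdeg, Cardinal.lift_natCast])

end TranscendenceDegree

section HilbertSeries

section Quasipolynomial

variable {R : Type*} [CommRing R]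

theorem one_sub_X_pow_mul_mk (s : ℕ) (a : ℕ → R) :
    (1 - PowerSeries.X ^ s) * PowerSeries.mk a =
      (PowerSeries.trunc s (PowerSeries.mk a) : PowerSeries R) +
        PowerSeries.X ^ s * PowerSeries.mk (fwdDiff s a) := by
  ext j
  rw [sub_mul, one_mul, map_sub, map_add, PowerSeries.coeff_X_pow_mul',
    PowerSeries.coeff_X_pow_mul', Polynomial.coeff_coe, PowerSeries.coeff_trunc,
    PowerSeries.coeff_mk, PowerSeries.coeff_mk, PowerSeries.coeff_mk]
  rcases lt_or_ge j s with hj | hj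
  · simp [hj, hj.not_ge]
  · simp [hj, hj.not_gt, fwdDiff]

theorem exists_polynomial_eq_one_sub_X_pow_mul_mk (s D : ℕ) (a : ℕ → R)
    (ha : (fwdDiff s)^[D + 1] a = 0) :
    ∃ p : Polynomial R, (1 - PowerSeries.X ^ s) ^ (D + 1) * PowerSeries.mk a = (p : PowerSeries R) ∧
      p.eval 1 = ∑ r ∈ Finset.range s, (fwdDiff s)^[D] a r := by
  induction D generalizing a with
  | zero =>
    refine ⟨PowerSeries.trunc s (PowerSeries.mk a), ?_, ?_⟩
    · rw [zero_add, pow_one, one_sub_X_pow_mul_mk, show fwdDiff s a = 0 from ha]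
      simp [show PowerSeries.mk (0 : ℕ → R) = 0 from rfl]
    · simp [Polynomial.eval, PowerSeries.eval₂_trunc_eq_sum_range]
  | succ D ih =>
    obtain ⟨p, hp, hp_one⟩ := ih (fwdDiff s a) ha
    refine ⟨(1 - Polynomial.X ^ s) ^ (D + 1) * PowerSeries.trunc s (PowerSeries.mk a) +
      Polynomial.X ^ s * p, ?_, ?_⟩
    · rw [pow_succ (_ - _), mul_assoc, one_sub_X_pow_mul_mk, mul_add, mul_left_comm, hp]
      simp
    · simp [hp_one]

end Quasipolynomial

theorem tendsto_one_sub_pow_mul_eval_div {s : ℕ} (hs : s ≠ 0) (D : ℕ) (p : Polynomial ℂ) :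
    Tendsto (fun z : ℂ => (1 - z) ^ D *
      (p.eval z / ((1 - Polynomial.X ^ s : Polynomial ℂ) ^ D).eval z)) (𝓝[≠] 1)
      (𝓝 (p.eval 1 / s ^ D)) := by
  have hcont : ContinuousAt (fun z : ℂ => p.eval z / (∑ i ∈ Finset.range s, z ^ i) ^ D) 1 :=
    p.continuous.continuousAt.div (by fun_prop) (by simp [hs])
  have hlim := hcont.tendsto.mono_left (nhdsWithin_le_nhds (s := {1}ᶜ))
  simp only [one_pow, Finset.sum_const, Finset.card_range, nsmul_eq_mul, mul_one] at hlim
  refine hlim.congr' ?_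
  filter_upwards [self_mem_nhdsWithin] with z hz
  have hz_pow : (1 - z) ^ D ≠ 0 := pow_ne_zero _ (sub_ne_zero.2 (Ne.symm hz))
  rw [Polynomial.eval_pow, Polynomial.eval_sub, Polynomial.eval_one, Polynomial.eval_pow,
    Polynomial.eval_X, ← mul_neg_geom_sum, mul_pow, mul_div_assoc', mul_div_mul_left _ _ hz_pow]

theorem trdeg_fractionRing (R A : Type*) [CommRing R] [Nontrivial R] [CommRing A] [IsDomain A]
    [Algebra R A] [FaithfulSMul R A] :
    Algebra.trdeg R (FractionRing A) = Algebra.trdeg R A := by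
  have : Algebra.IsAlgebraic A (FractionRing A) :=
    IsFractionRing.comap_isAlgebraic_iff (K := FractionRing A).mpr inferInstance
  rw [← trdeg_add_eq R A (A := FractionRing A),
    (trdeg_eq_zero : Algebra.trdeg A (FractionRing A) = 0), add_zero]

theorem fwdDiff_iter_comp_mul_add {G : Type*} [AddCommGroup G] (a : ℕ → G) (s r D k : ℕ) :
    (fwdDiff s)^[D] a (s * k + r) = (fwdDiff 1)^[D] (fun l => a (s * l + r)) k := by
  rw [fwdDiff_iter_eq_sum_shift, fwdDiff_iter_eq_sum_shift]
  refine Finset.sum_congr rfl fun i _ => ?_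
  congr 2
  simp only [smul_eq_mul]
  ring

theorem hasDegree_of_fwdDiff_iter_finrank {R : Type*} [CommRing R] [IsDomain R] [Algebra ℂ R]
    {𝒜 : ℕ → Submodule ℂ R} (hfin : ∀ j, Module.Finite ℂ (𝒜 j)) {D : ℕ}
    (htrdeg : Algebra.trdeg ℂ R = (D + 1 : ℕ)) {s : ℕ} (hs : s ≠ 0) (c : ℕ → ℂ)
    (hc : ∀ r < s, ∀ k,
      (fwdDiff 1)^[D] (fun l => (Module.finrank ℂ (𝒜 (s * l + r)) : ℂ)) k = c r) :
    HasDegree 𝒜 ((∑ r ∈ Finset.range s, c r) / s ^ (D + 1)) := by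
  set a : ℕ → ℂ := fun j => Module.finrank ℂ (𝒜 j)
  have hperiodic (j : ℕ) : (fwdDiff s)^[D] a j = c (j % s) := by
    conv_lhs => rw [← Nat.div_add_mod j s]
    rw [fwdDiff_iter_comp_mul_add]
    exact hc _ (Nat.mod_lt _ hs.pos) _
  have hvanish : (fwdDiff s)^[D + 1] a = 0 := by
    rw [Function.iterate_succ_apply']
    ext j
    simp [fwdDiff, hperiodic]
  obtain ⟨p, hp, hp_one⟩ := exists_polynomial_eq_one_sub_X_pow_mul_mk s D a hvanish
  have hsum : p.eval 1 = ∑ r ∈ Finset.range s, c r := hp_one.trans <|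
    Finset.sum_congr rfl fun r hr => by rw [hperiodic, Nat.mod_eq_of_lt (Finset.mem_range.1 hr)]
  refine ⟨hfin, D + 1, (trdeg_fractionRing ℂ R).trans htrdeg, p, (1 - Polynomial.X ^ s) ^ (D + 1),
    ?_, ?_, hsum ▸ tendsto_one_sub_pow_mul_eval_div hs _ p⟩
  · refine pow_ne_zero _ fun h => ?_
    simpa [hs] using congrArg (Polynomial.eval 0) h
  · rw [← hp]
    simp [poincareSeries, a]

end HilbertSeries

section InvariantSpace

variable {K ι : Type*} [Field K]

theorem finrank_restrictSupport {σ : Type*} (s : Set (σ →₀ ℕ)) :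
    Module.finrank K (restrictSupport K s) = s.ncard := by
  rw [Module.finrank_eq_nat_card_basis (basisRestrictSupport K s), Nat.card_coe_set_eq]

theorem finite_restrictSupport {σ : Type*} {s : Set (σ →₀ ℕ)} (hs : s.Finite) :
    Module.Finite K (restrictSupport K s) := by
  have := hs.to_subtype
  exact Module.Finite.of_basis (basisRestrictSupport K s)

theorem restrictSupport_inf {σ : Type*} (s t : Set (σ →₀ ℕ)) :
    restrictSupport K s ⊓ restrictSupport K t = restrictSupport K (s ∩ t) := by
  ext F
  simp only [Submodule.mem_inf, mem_restrictSupport_iff, Set.subset_inter_iff]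

theorem finite_setOf_multidegree_mem {κ : Type*} [Finite ι] [Fintype κ] {𝒢 : Set (ι → ℕ)}
    (h𝒢 : 𝒢.Finite) :
    {m : ι × κ →₀ ℕ | multidegree m ∈ 𝒢}.Finite := by
  classical
  obtain ⟨B, hB⟩ := h𝒢.bddAbove
  refine (Set.finite_Iic (Finsupp.equivFunOnFinite.symm fun p : ι × κ => B p.1)).subset ?_
  rintro m hm ⟨i, k⟩
  exact (Finset.single_le_sum (f := fun k => m (i, k)) (fun _ _ => Nat.zero_le _)
    (Finset.mem_univ k)).trans (hB hm i)

/-- The invariants of binary forms all of whose monomials have their multidegree in `𝒢`. -/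
noncomputable def invariantSpace (K : Type*) {ι : Type*} [Field K] (𝒢 : Set (ι → ℕ)) :
    Submodule K (MvPolynomial (ι × Fin 2) K) :=
  Subalgebra.toSubmodule (polarInvariants K ι (Fin 2)) ⊓
    restrictSupport K {m | multidegree m ∈ 𝒢}

theorem invariantSpace_mono {𝒢 𝒢' : Set (ι → ℕ)} (h : 𝒢 ⊆ 𝒢') :
    invariantSpace K 𝒢 ≤ invariantSpace K 𝒢' :=
  inf_le_inf_left _ (restrictSupport_mono _ fun _ hm => h hm)

theorem finite_invariantSpace [Finite ι] {𝒢 : Set (ι → ℕ)} (h𝒢 : 𝒢.Finite) :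
    Module.Finite K (invariantSpace K 𝒢) := by
  have := finite_restrictSupport (K := K) (finite_setOf_multidegree_mem (κ := Fin 2) h𝒢)
  exact Submodule.finiteDimensional_of_le
    (inf_le_right : invariantSpace K 𝒢 ≤ restrictSupport K {m | multidegree m ∈ 𝒢})

theorem toSubmodule_polarInvariants :
    Subalgebra.toSubmodule (polarInvariants K ι (Fin 2)) =
      LinearMap.ker (polarization K ι 0 1).toLinearMap ⊓
        LinearMap.ker (polarization K ι 1 0).toLinearMap := by
  ext F
  refine ⟨fun h => ⟨h 0 1 (by decide), h 1 0 (by decide)⟩, fun h i j hij => ?_⟩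
  fin_cases i <;> fin_cases j
  · exact absurd rfl hij
  · exact h.1
  · exact h.2
  · exact absurd rfl hij

theorem finrank_invariantSpace_add_ncard [CharZero K] [Fintype ι] {𝒢 : Set (ι → ℕ)}
    (h𝒢 : 𝒢.Finite) :
    Module.finrank K (invariantSpace K 𝒢) +
      {m : ι × Fin 2 →₀ ℕ | multidegree m ∈ 𝒢 ∧ colDegree m 0 = colDegree m 1 + 2}.ncard =
        {m : ι × Fin 2 →₀ ℕ | multidegree m ∈ 𝒢 ∧ colDegree m 0 = colDegree m 1}.ncard := by
  have := finite_restrictSupport (K := K) (finite_setOf_multidegree_mem (κ := Fin 2) h𝒢)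
  have hpol (i j : Fin 2) (F) (hF : F ∈ restrictSupport K {m | multidegree m ∈ 𝒢}) :=
    polarization_mem_restrictSupport_multidegree i j hF
  have hsl := isSl2Rep_polarization.finrank_inf_ker_inf_ker_add_finrank_inf_eigenspace
    (restrictSupport K {m : ι × Fin 2 →₀ ℕ | multidegree m ∈ 𝒢})
    (fun F hF => sub_mem (hpol 0 0 F hF) (hpol 1 1 F hF)) (hpol 0 1) (hpol 1 0)
  rw [← toSubmodule_polarInvariants, inf_comm] at hsl
  have h_two := eigenspace_weightDerivation (K := K) (ι := ι) 2
  have h_zero := eigenspace_weightDerivation (K := K) (ι := ι) 0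
  rw [Nat.cast_ofNat] at h_two
  rw [Nat.cast_zero] at h_zero
  rw [h_two, h_zero, restrictSupport_inf, restrictSupport_inf, finrank_restrictSupport,
    finrank_restrictSupport] at hsl
  exact hsl

end InvariantSpace

section Counting

theorem sum_multidegree {ι κ : Type*} [Fintype ι] [Fintype κ] (m : ι × κ →₀ ℕ) :
    ∑ p, multidegree m p = ∑ k, colDegree m k :=
  Finset.sum_comm

theorem ncard_setOf_colDegree_eq (ι : Type*) {κ : Type*} [Fintype ι] [Fintype κ] (q : κ → ℕ) :
    {m : ι × κ →₀ ℕ | colDegree m = q}.ncard = ∏ k, (Fintype.card ι).multichoose (q k) := by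
  classical
  let e : (ι × κ →₀ ℕ) ≃ (κ → ι →₀ ℕ) :=
    (Finsupp.domCongr (Equiv.prodComm ι κ)).toEquiv.trans
      (Finsupp.curryEquiv.trans Finsupp.equivFunOnFinite)
  have he : {m : ι × κ →₀ ℕ | colDegree m = q} =
      e ⁻¹' (Fintype.piFinset fun k => (Finset.univ : Finset ι).finsuppAntidiag (q k)) := by
    ext m
    simp only [e, colDegree, _root_.funext_iff, Set.mem_ofPred_eq, Set.mem_preimage,
      Finset.mem_coe, Fintype.mem_piFinset, Finset.mem_finsuppAntidiag, Finset.subset_univ,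
      and_true]
    rfl
  rw [he, Set.ncard_preimage_of_injective_subset_range e.injective (by simp),
    Set.ncard_coe_finset, Fintype.card_piFinset]
  simp only [Finset.card_finsuppAntidiag_nat_eq_multichoose, Finset.card_univ]

theorem ncard_setOf_colDegree_fin_two_eq (ι : Type*) [Fintype ι] (p q : ℕ) :
    {m : ι × Fin 2 →₀ ℕ | colDegree m 0 = p ∧ colDegree m 1 = q}.ncard =
      (Fintype.card ι).multichoose p * (Fintype.card ι).multichoose q := by
  have := ncard_setOf_colDegree_eq ι ![p, q]
  simpa [_root_.funext_iff] using this

theorem finite_setOf_sum_eq (ι : Type*) [Fintype ι] (j : ℕ) :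
    {μ : ι → ℕ | ∑ i, μ i = j}.Finite := by
  classical
  refine (Set.finite_Iic fun _ : ι => j).subset fun μ hμ i => ?_
  exact hμ ▸ Finset.single_le_sum (fun _ _ => Nat.zero_le _) (Finset.mem_univ i)

theorem multichoose_succ_left (m k : ℕ) : (m + 1).multichoose k = (m + k).choose m := by
  rw [Nat.multichoose_eq, show m + 1 + k - 1 = m + k by omega, Nat.choose_symm_add]

theorem choose_mul_choose_add_succ_mul (m k : ℕ) :
    (k + m).choose m * (k + m + 1).choose m +
      (m + 1) * ((k + m + 2).choose (m + 1) * (k + m).choose (m + 1)) =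
        (m + 1) * ((k + m + 1).choose (m + 1) * (k + m + 1).choose (m + 1)) := by
  have hright : (k + m).choose (m + 1) * (m + 1) = (k + m).choose m * k := by
    rw [Nat.choose_succ_right_eq, Nat.add_sub_cancel]
  have hup : (k + m + 1) * (k + m).choose m = (k + m + 1).choose m * (k + 1) := by
    have := Nat.choose_mul_succ_eq (k + m) m
    rwa [show k + m + 1 - m = k + 1 by omega, mul_comm] at this
  rw [Nat.choose_succ_succ' (k + m + 1) m, Nat.choose_succ_succ' (k + m) m]
  zify at hright hup ⊢
  linear_combination ((k + m + 1).choose m - (k + m).choose m : ℤ) * hright -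
    ((k + m).choose m : ℤ) * hup

theorem succ_mul_finrank_invariantSpace_two_mul (K : Type*) {ι : Type*} [Field K] [CharZero K]
    [Fintype ι] {m : ℕ} (hm : Fintype.card ι = m + 2) (k : ℕ) :
    (m + 1) * Module.finrank K (invariantSpace K {μ : ι → ℕ | ∑ i, μ i = 2 * k}) =
      (k + m).choose m * (k + m + 1).choose m := by
  have hset (p q w : ℕ) (hp : p = q + w) (hk : p + q = 2 * k) :
      {a : ι × Fin 2 →₀ ℕ | multidegree a ∈ {μ : ι → ℕ | ∑ i, μ i = 2 * k} ∧
        colDegree a 0 = colDegree a 1 + w}.ncard = (m + 1 + p).choose (m + 1) *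
          (m + 1 + q).choose (m + 1) := by
    rw [← multichoose_succ_left, ← multichoose_succ_left, ← hm, ← ncard_setOf_colDegree_fin_two_eq]
    congr 1
    ext a
    simp only [Set.mem_ofPred_eq, sum_multidegree, Fin.sum_univ_two]
    omega
  have hzero := hset k k 0 rfl (by omega)
  have htwo : {a : ι × Fin 2 →₀ ℕ | multidegree a ∈ {μ : ι → ℕ | ∑ i, μ i = 2 * k} ∧
      colDegree a 0 = colDegree a 1 + 2}.ncard =
        (k + m + 2).choose (m + 1) * (k + m).choose (m + 1) := by
    cases k with
    | zero =>
      rw [zero_add, Nat.choose_succ_self, mul_zero]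
      refine (congrArg Set.ncard ?_).trans (Set.ncard_empty _)
      refine Set.eq_empty_of_forall_notMem fun a ha => ?_
      simp only [Set.mem_ofPred_eq, sum_multidegree, Fin.sum_univ_two] at ha
      omega
    | succ k =>
      rw [hset (k + 2) k 2 rfl (by omega)]
      congr 2 <;> ring
  have hdim := finrank_invariantSpace_add_ncard (K := K) (finite_setOf_sum_eq ι (2 * k))
  have hid := choose_mul_choose_add_succ_mul m k
  simp only [add_zero] at hzero
  rw [htwo, hzero, show m + 1 + k = k + m + 1 by ring] at hdim
  rw [← hdim, mul_add] at hid
  omega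

theorem finrank_invariantSpace_two_mul_add_one (K ι : Type*) [Field K] [CharZero K]
    [Fintype ι] (k : ℕ) :
    Module.finrank K (invariantSpace K {μ : ι → ℕ | ∑ i, μ i = 2 * k + 1}) = 0 := by
  have hdim := finrank_invariantSpace_add_ncard (K := K) (finite_setOf_sum_eq ι (2 * k + 1))
  have hempty : {m : ι × Fin 2 →₀ ℕ | multidegree m ∈ {μ : ι → ℕ | ∑ i, μ i = 2 * k + 1} ∧
      colDegree m 0 = colDegree m 1} = ∅ := by
    refine Set.eq_empty_of_forall_notMem fun m hm => ?_
    simp only [Set.mem_ofPred_eq, sum_multidegree, Fin.sum_univ_two] at hm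
    omega
  rw [hempty, Set.ncard_empty] at hdim
  omega

end Counting

section CovariantCounting

theorem ncard_setOf_eq_ncard_add_single_add {σ : Type*} (s : σ) {P : (σ →₀ ℕ) → Prop}
    (hP : {m | P m}.Finite) :
    {m | P m}.ncard =
      {m | P (m + Finsupp.single s 1)}.ncard + {m | P m ∧ m s = 0}.ncard := by
  have himage : {m | P m ∧ m s ≠ 0} =
      (· + Finsupp.single s 1) '' {m | P (m + Finsupp.single s 1)} := by
    refine Set.Subset.antisymm (fun m hm => ?_) ?_
    · have hsub : m - Finsupp.single s 1 + Finsupp.single s 1 = m :=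
        tsub_add_cancel_of_le (Finsupp.single_le_iff.2 (Nat.one_le_iff_ne_zero.2 hm.2))
      exact ⟨m - Finsupp.single s 1, (congrArg P hsub).mpr hm.1, hsub⟩
    · rintro _ ⟨m, hm, rfl⟩
      refine ⟨hm, ?_⟩
      rw [Finsupp.add_apply, Finsupp.single_eq_same]
      exact Nat.succ_ne_zero _
  rw [← Set.ncard_image_of_injective {m | P (m + Finsupp.single s 1)}
      (add_left_injective (Finsupp.single s 1)), ← himage,
    ← Set.ncard_union_eq (Set.disjoint_left.2 fun m hm hm' => hm.2 hm'.2)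
      (hP.subset fun m hm => hm.1) (hP.subset fun m hm => hm.1)]
  congr 1
  ext m
  simp only [Set.mem_ofPred_eq, Set.mem_union]
  tauto

theorem ncard_setOf_colDegree_swap {ι : Type*} [Fintype ι] (𝒢 : Set (ι → ℕ)) (i : ι) (w : ℕ) :
    {m : ι × Fin 2 →₀ ℕ | (multidegree m ∈ 𝒢 ∧ colDegree m 0 = colDegree m 1 + w) ∧
      m (i, 0) = 0}.ncard =
    {m : ι × Fin 2 →₀ ℕ | (multidegree m ∈ 𝒢 ∧ colDegree m 1 = colDegree m 0 + w) ∧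
      m (i, 1) = 0}.ncard := by
  let e : (ι × Fin 2 →₀ ℕ) ≃ (ι × Fin 2 →₀ ℕ) :=
    (Finsupp.domCongr ((Equiv.refl ι).prodCongr (Equiv.swap 0 1))).toEquiv
  have hmulti (m) : multidegree (e m) = multidegree m :=
    _root_.funext fun p => Equiv.sum_comp (Equiv.swap 0 1) fun k => m (p, k)
  rw [← Set.ncard_preimage_of_injective_subset_range e.injective (by simp)]
  congr 1
  ext m
  simp only [Set.mem_preimage, Set.mem_ofPred_eq, hmulti]
  rfl

theorem finrank_invariantSpace_add_ncard_eq_zero (K : Type*) {ι : Type*} [Field K] [CharZero K]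
    [Fintype ι] {𝒢 : Set (ι → ℕ)} (h𝒢 : 𝒢.Finite) (i : ι) :
    Module.finrank K (invariantSpace K 𝒢) +
      {m : ι × Fin 2 →₀ ℕ | (multidegree m ∈ 𝒢 ∧ colDegree m 1 = colDegree m 0 + 2) ∧
        m (i, 1) = 0}.ncard =
      {m : ι × Fin 2 →₀ ℕ | (multidegree m ∈ 𝒢 ∧ colDegree m 1 = colDegree m 0) ∧
        m (i, 1) = 0}.ncard := by
  classical
  have hfin (Q : (ι × Fin 2 →₀ ℕ) → Prop) : {m | multidegree m ∈ 𝒢 ∧ Q m}.Finite :=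
    (finite_setOf_multidegree_mem h𝒢).subset fun m hm => hm.1
  have hdim := finrank_invariantSpace_add_ncard (K := K) h𝒢
  rw [ncard_setOf_eq_ncard_add_single_add (i, 0) (hfin _),
    ncard_setOf_eq_ncard_add_single_add (i, 1) (hfin _), ncard_setOf_colDegree_swap] at hdim
  have hshift : {m : ι × Fin 2 →₀ ℕ | multidegree (m + .single (i, 0) 1) ∈ 𝒢 ∧
      colDegree (m + .single (i, 0) 1) 0 = colDegree (m + .single (i, 0) 1) 1 + 2} =
    {m : ι × Fin 2 →₀ ℕ | multidegree (m + .single (i, 1) 1) ∈ 𝒢 ∧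
      colDegree (m + .single (i, 1) 1) 0 = colDegree (m + .single (i, 1) 1) 1} := by
    ext m
    simp [multidegree_add, multidegree_single, colDegree_add, colDegree_single]
  rw [hshift] at hdim
  have hcomm (m : ι × Fin 2 →₀ ℕ) :
      colDegree m 1 = colDegree m 0 ↔ colDegree m 0 = colDegree m 1 := eq_comm
  simp only [hcomm]
  omega

/-- The multidegrees of degree `j` in the forms indexed by `α` and of degree at most `D` in the
remaining form `none`. The remaining form stands for the vector on which a covariant of the forms
depends, so these are the multidegrees of covariants of degree `j` and of order at most `D`. -/
def boundedOrder (α : Type*) [Fintype α] (j D : ℕ) : Set (Option α → ℕ) :=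
  {μ | ∑ i, μ (some i) = j ∧ μ none ≤ D}

theorem finite_boundedOrder (α : Type*) [Fintype α] (j D : ℕ) : (boundedOrder α j D).Finite := by
  classical
  refine (Set.finite_Iic fun i : Option α => i.elim D fun _ => j).subset ?_
  rintro μ ⟨hj, hD⟩ (_ | i)
  · exact hD
  · exact hj ▸ Finset.single_le_sum (f := fun i => μ (some i)) (fun _ _ => Nat.zero_le _)
      (Finset.mem_univ i)

/-- The exponents of the variables of the forms indexed by `α`, those of the form `none` being
dropped. -/
noncomputable def dropNone {α κ : Type*} [Finite α] [Finite κ] (m : Option α × κ →₀ ℕ) :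
    α × κ →₀ ℕ :=
  Finsupp.equivFunOnFinite.symm fun p => m (some p.1, p.2)

theorem colDegree_eq_add_colDegree_dropNone {α κ : Type*} [Fintype α] [Finite κ]
    (m : Option α × κ →₀ ℕ) (k : κ) :
    colDegree m k = m (none, k) + colDegree (dropNone m) k :=
  Fintype.sum_option _

theorem sum_multidegree_some {α : Type*} [Fintype α] (m : Option α × Fin 2 →₀ ℕ) :
    ∑ i, multidegree m (some i) = colDegree (dropNone m) 0 + colDegree (dropNone m) 1 :=
  (sum_multidegree (dropNone m)).trans (Fin.sum_univ_two _)

theorem ncard_setOf_boundedOrder (α : Type*) [Fintype α] {j D : ℕ} (hD : j ≤ D) (w : ℕ) :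
    {m : Option α × Fin 2 →₀ ℕ | (multidegree m ∈ boundedOrder α j D ∧
      colDegree m 1 = colDegree m 0 + w) ∧ m (none, 1) = 0}.ncard =
    {m : α × Fin 2 →₀ ℕ | colDegree m 0 + colDegree m 1 = j ∧
      colDegree m 0 + w ≤ colDegree m 1}.ncard := by
  have hcol := colDegree_eq_add_colDegree_dropNone (α := α) (κ := Fin 2)
  refine Set.ncard_congr (fun m _ => dropNone m) ?_ ?_ ?_
  · rintro m ⟨⟨⟨hj, -⟩, hw⟩, h1⟩
    rw [sum_multidegree_some] at hj
    rw [hcol m 0, hcol m 1] at hw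
    exact ⟨hj, by omega⟩
  · rintro m m' ⟨⟨-, hw⟩, h1⟩ ⟨⟨-, hw'⟩, h1'⟩ heq
    rw [hcol m 0, hcol m 1, heq] at hw
    rw [hcol m' 0, hcol m' 1] at hw'
    ext ⟨_ | i, k⟩
    · fin_cases k
      · change m (none, 0) = m' (none, 0)
        omega
      · exact h1.trans h1'.symm
    · exact DFunLike.congr_fun heq (i, k)
  · rintro m ⟨hj, hw⟩
    let m' : Option α × Fin 2 →₀ ℕ := Finsupp.equivFunOnFinite.symm fun p =>
      p.1.elim (![colDegree m 1 - colDegree m 0 - w, 0] p.2) fun i => m (i, p.2)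
    have hm' : dropNone m' = m := Finsupp.ext fun p => rfl
    have hm0 : m' (none, 0) = colDegree m 1 - colDegree m 0 - w := rfl
    have hm1 : m' (none, 1) = 0 := rfl
    refine ⟨m', ⟨⟨⟨?_, ?_⟩, ?_⟩, hm1⟩, hm'⟩
    · rw [sum_multidegree_some, hm', hj]
    · rw [multidegree, Fin.sum_univ_two]
      omega
    · rw [hcol m' 0, hcol m' 1, hm']
      omega

theorem finrank_invariantSpace_boundedOrder (K α : Type*) [Field K] [CharZero K] [Fintype α]
    {j D : ℕ} (hD : j ≤ D) :
    Module.finrank K (invariantSpace K (boundedOrder α j D)) =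
      (Fintype.card α).multichoose (j / 2) * (Fintype.card α).multichoose (j - j / 2) := by
  have hdim := finrank_invariantSpace_add_ncard_eq_zero K (finite_boundedOrder α j D) none
  have hfin : {m : α × Fin 2 →₀ ℕ | colDegree m 0 + colDegree m 1 = j}.Finite := by
    convert finite_setOf_multidegree_mem (κ := Fin 2) (finite_setOf_sum_eq α j) using 3 with m
    rw [Set.mem_ofPred_eq, sum_multidegree, Fin.sum_univ_two]
  have hunion : {m : α × Fin 2 →₀ ℕ | colDegree m 0 + colDegree m 1 = j ∧
      colDegree m 0 ≤ colDegree m 1} =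
    {m | colDegree m 0 = j / 2 ∧ colDegree m 1 = j - j / 2} ∪
      {m | colDegree m 0 + colDegree m 1 = j ∧ colDegree m 0 + 2 ≤ colDegree m 1} := by
    ext m
    simp only [Set.mem_ofPred_eq, Set.mem_union]
    omega
  have hdisj : Disjoint
      {m : α × Fin 2 →₀ ℕ | colDegree m 0 = j / 2 ∧ colDegree m 1 = j - j / 2}
      {m | colDegree m 0 + colDegree m 1 = j ∧ colDegree m 0 + 2 ≤ colDegree m 1} := by
    refine Set.disjoint_left.2 fun m hm hm' => ?_
    simp only [Set.mem_ofPred_eq] at hm hm'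
    omega
  have hzero := ncard_setOf_boundedOrder α hD 0
  simp only [add_zero] at hzero
  rw [ncard_setOf_boundedOrder α hD, hzero, hunion,
    Set.ncard_union_eq hdisj (hfin.subset fun m hm => by simp only [Set.mem_ofPred_eq] at *; omega)
      (hfin.subset fun m hm => hm.1),
    ncard_setOf_colDegree_fin_two_eq] at hdim
  omega

theorem invariantSpace_setOf_sum_some_eq (K α : Type*) [Field K] [CharZero K] [Fintype α]
    (j : ℕ) :
    invariantSpace K {μ : Option α → ℕ | ∑ i, μ (some i) = j} =
      invariantSpace K (boundedOrder α j j) := by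
  refine le_antisymm ?_ (invariantSpace_mono fun μ hμ => hμ.1)
  rintro F ⟨hinv, hsupp⟩
  let D := max j (F.support.sup fun m => multidegree m none)
  have := finite_invariantSpace (K := K) (finite_boundedOrder α j D)
  have hle : invariantSpace K (boundedOrder α j j) ≤ invariantSpace K (boundedOrder α j D) :=
    invariantSpace_mono fun μ hμ => ⟨hμ.1, hμ.2.trans (le_max_left _ _)⟩
  rw [Submodule.eq_of_le_of_finrank_eq hle (by
    rw [finrank_invariantSpace_boundedOrder K α le_rfl,
      finrank_invariantSpace_boundedOrder K α (le_max_left _ _)])]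
  exact ⟨hinv, fun m hm => ⟨hsupp hm, le_max_of_le_right
    (Finset.le_sup (f := fun m : Option α × Fin 2 →₀ ℕ => multidegree m none) hm)⟩⟩

end CovariantCounting

section Covariants

/-- The identification of the polynomials in `n` binary forms and a vector with the polynomials in
`n + 1` binary forms: the vector `(x₀, x₁)` becomes the form `(-x₁, x₀)` with index `none`. -/
noncomputable def vectorToForm (n : ℕ) : MvPolynomial ((Fin n × Fin 2) ⊕ Fin 2) ℂ ≃ₐ[ℂ]
    MvPolynomial (Option (Fin n) × Fin 2) ℂ :=
  AlgEquiv.ofAlgHom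
    (aeval (Sum.elim (fun p => X (some p.1, p.2)) ![X (none, 1), -X (none, 0)]))
    (aeval fun p => p.1.elim (![-X (Sum.inr 1), X (Sum.inr 0)] p.2) fun i => X (Sum.inl (i, p.2)))
    (algHom_ext fun p => by obtain ⟨_ | i, k⟩ := p <;> fin_cases k <;> simp)
    (algHom_ext fun p => by
      obtain p | k := p
      · simp
      · fin_cases k <;> simp)

theorem evalMatrix_vectorToForm {n : ℕ} (a : Matrix (Option (Fin n)) (Fin 2) ℂ)
    (F : MvPolynomial ((Fin n × Fin 2) ⊕ Fin 2) ℂ) :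
    evalMatrix a (vectorToForm n F) =
      evalFormsVec (fun i => a (some i)) ![a none 1, -a none 0] F := by
  have hcomp : (evalMatrix a).comp (vectorToForm n).toAlgHom =
      evalFormsVec (fun i => a (some i)) ![a none 1, -a none 0] := by
    refine algHom_ext fun p => ?_
    obtain p | k := p
    · simp [vectorToForm, evalFormsVec, evalMatrix]
    · fin_cases k <;> simp [vectorToForm, evalFormsVec, evalMatrix]
  exact DFunLike.congr_fun hcomp F

-- `ℂ²` and its dual are isomorphic representations because `g⁻¹` is the adjugate of `g`.
theorem actVec_symplectic_dual (g : SL(2, ℂ)) {ι : Type*} (a : Matrix ι (Fin 2) ℂ) (i : ι) :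
    actVec g ![a i 1, -a i 0] =
      ![(a * (g⁻¹ : SL(2, ℂ)).1) i 1, -(a * (g⁻¹ : SL(2, ℂ)).1) i 0] := by
  ext k
  fin_cases k <;>
    simp [actVec, Matrix.mul_apply, Matrix.mulVec, dotProduct, Fin.sum_univ_two,
      Matrix.SpecialLinearGroup.coe_inv, Matrix.adjugate_fin_two] <;> ring

theorem mem_jointCovariants_iff {n : ℕ} (F : MvPolynomial ((Fin n × Fin 2) ⊕ Fin 2) ℂ) :
    F ∈ jointCovariants n ↔ vectorToForm n F ∈ polarInvariants ℂ (Option (Fin n)) (Fin 2) := by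
  rw [mem_polarInvariants_fin_two_iff]
  have hact (g : SL(2, ℂ)) (a : Matrix (Option (Fin n)) (Fin 2) ℂ) :
      evalMatrix (a * (g⁻¹ : SL(2, ℂ)).1) (vectorToForm n F) =
        evalFormsVec (actForms g fun i => a (some i)) (actVec g ![a none 1, -a none 0]) F := by
    rw [evalMatrix_vectorToForm, actVec_symplectic_dual]
    rfl
  constructor
  · intro h g a
    rw [← inv_inv g, hact, evalMatrix_vectorToForm]
    exact h g⁻¹ _ _
  · intro h g a x
    let b : Matrix (Option (Fin n)) (Fin 2) ℂ := fun i => i.elim ![-x 1, x 0] a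
    have hx : ![b none 1, -b none 0] = x := by
      ext k
      fin_cases k <;> simp [b]
    have hb := h g⁻¹ b
    rwa [hact, evalMatrix_vectorToForm, hx] at hb

end Covariants

section GradedPieces

theorem weightedHomogeneousSubmodule_fst_eq {ι κ K : Type*} [Fintype ι] [Fintype κ] [CommSemiring K]
    (w : ι → ℕ) (j : ℕ) :
    weightedHomogeneousSubmodule K (fun p : ι × κ => w p.1) j =
      restrictSupport K {m | multidegree m ∈ {μ | ∑ i, μ i * w i = j}} := by
  have hweight (m : ι × κ →₀ ℕ) :
      Finsupp.weight (fun p : ι × κ => w p.1) m = ∑ i, multidegree m i * w i := by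
    rw [Finsupp.weight_apply, Finsupp.sum_fintype _ _ (by simp), Fintype.sum_prod_type]
    simp [multidegree, Finset.sum_mul]
  ext F
  simp only [mem_weightedHomogeneousSubmodule, IsWeightedHomogeneous, hweight,
    mem_restrictSupport_iff, ← mem_support_iff]
  rfl

theorem nonempty_comap_val_linearEquiv {K A B : Type*} [CommRing K] [CommRing A] [Algebra K A]
    [AddCommGroup B] [Module K B] (e : A ≃ₗ[K] B) (S : Subalgebra K A) (W : Submodule K A)
    (V : Submodule K B) (h : ∀ x, x ∈ S ∧ x ∈ W ↔ e x ∈ V) :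
    Nonempty (W.comap S.val.toLinearMap ≃ₗ[K] V) := by
  have hmap : (W.comap S.val.toLinearMap).map (e.toLinearMap ∘ₗ S.val.toLinearMap) = V := by
    ext y
    constructor
    · rintro ⟨x, hx, rfl⟩
      exact (h x).1 ⟨x.2, hx⟩
    · intro hy
      have hx := (h (e.symm y)).2 (by rwa [e.apply_symm_apply])
      exact ⟨⟨e.symm y, hx.1⟩, hx.2, e.apply_symm_apply y⟩
  rw [← hmap]
  exact ⟨Submodule.equivMapOfInjective _ (fun _ _ hxy => Subtype.ext (e.injective hxy)) _⟩

theorem nonempty_invariantsPiece_linearEquiv (n j : ℕ) :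
    Nonempty (invariantsPiece n j ≃ₗ[ℂ] invariantSpace ℂ {μ : Fin n → ℕ | ∑ i, μ i = j}) := by
  refine nonempty_comap_val_linearEquiv (LinearEquiv.refl ℂ _) _ _ _ fun F => ?_
  have hhom := weightedHomogeneousSubmodule_fst_eq (κ := Fin 2) (K := ℂ) (fun _ : Fin n => 1) j
  simp only [mul_one] at hhom
  rw [jointInvariants_eq_polarInvariants, LinearEquiv.refl_apply, invariantSpace, ← hhom]
  rfl

theorem isWeightedHomogeneous_aeval {σ τ : Type*} {R : Type*} [CommSemiring R] {w : σ → ℕ}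
    {w' : τ → ℕ} {f : σ → MvPolynomial τ R} (hf : ∀ i, IsWeightedHomogeneous w' (f i) (w i)) {j : ℕ}
    {F : MvPolynomial σ R} (hF : IsWeightedHomogeneous w F j) :
    IsWeightedHomogeneous w' (aeval f F) j := by
  rw [F.as_sum, map_sum]
  refine IsWeightedHomogeneous.sum _ _ _ fun m hm => ?_
  rw [aeval_monomial, ← hF (mem_support_iff.1 hm), Finsupp.weight_apply]
  exact (IsWeightedHomogeneous.prod _ _ (fun i => m i • w i) fun i _ => (hf i).pow _).C_mul _

theorem isWeightedHomogeneous_vectorToForm_iff {n j : ℕ}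
    (F : MvPolynomial ((Fin n × Fin 2) ⊕ Fin 2) ℂ) :
    IsWeightedHomogeneous (Sum.elim (fun _ => 1) fun _ => 0) F j ↔
      IsWeightedHomogeneous (fun p : Option (Fin n) × Fin 2 => p.1.elim 0 fun _ => 1)
        (vectorToForm n F) j := by
  have hX {σ : Type} (w : σ → ℕ) (p : σ) (k : ℕ) (hk : w p = k) :
      IsWeightedHomogeneous w (X p : MvPolynomial σ ℂ) k :=
    hk ▸ isWeightedHomogeneous_X ℂ w p
  constructor
  · refine isWeightedHomogeneous_aeval fun p => ?_
    obtain p | k := p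
    · exact hX _ _ _ rfl
    · fin_cases k
      · exact hX _ _ _ rfl
      · exact (hX _ _ _ rfl).neg
  · intro h
    rw [← (vectorToForm n).symm_apply_apply F]
    refine isWeightedHomogeneous_aeval (fun p => ?_) h
    obtain ⟨_ | i, k⟩ := p
    · fin_cases k
      · exact (hX _ _ _ rfl).neg
      · exact hX _ _ _ rfl
    · exact hX _ _ _ rfl

theorem nonempty_covariantsPiece_linearEquiv (n j : ℕ) :
    Nonempty (covariantsPiece n j ≃ₗ[ℂ]
      invariantSpace ℂ {μ : Option (Fin n) → ℕ | ∑ i, μ (some i) = j}) := by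
  refine nonempty_comap_val_linearEquiv (vectorToForm n).toLinearEquiv _ _ _ fun F => ?_
  have hhom := weightedHomogeneousSubmodule_fst_eq (κ := Fin 2) (K := ℂ)
    (fun i : Option (Fin n) => i.elim 0 fun _ => 1) j
  simp only [Fintype.sum_option, Option.elim_none, Option.elim_some, mul_zero, zero_add,
    mul_one] at hhom
  rw [mem_jointCovariants_iff, mem_weightedHomogeneousSubmodule,
    isWeightedHomogeneous_vectorToForm_iff, invariantSpace, ← hhom]
  rfl

theorem trdeg_jointCovariants {n : ℕ} (hn : 1 ≤ n) :
    Algebra.trdeg ℂ (jointCovariants n) = (2 * n - 1 : ℕ) := by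
  have hmap : (jointCovariants n).map (vectorToForm n).toAlgHom =
      polarInvariants ℂ (Option (Fin n)) (Fin 2) := by
    ext G
    refine ⟨?_, fun hG => ⟨(vectorToForm n).symm G, ?_, (vectorToForm n).apply_symm_apply G⟩⟩
    · rintro ⟨F, hF, rfl⟩
      exact (mem_jointCovariants_iff F).1 hF
    · exact (mem_jointCovariants_iff _).2 (by rwa [AlgEquiv.apply_symm_apply])
  rw [((vectorToForm n).subalgebraMap _).trdeg_eq, hmap,
    trdeg_polarInvariants (by rw [Fintype.card_option, Fintype.card_fin]; omega),
    Fintype.card_option, Fintype.card_fin]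
  congr 1

end GradedPieces

section Numerics

theorem fwdDiff_iter_eval_natCast {R : Type*} [CommRing R] (p : Polynomial R) (k : ℕ) :
    (fwdDiff 1)^[p.natDegree] (fun k : ℕ => p.eval (k : R)) k =
      p.leadingCoeff * p.natDegree.factorial := by
  have hcast : (fwdDiff 1)^[p.natDegree] (fun k : ℕ => p.eval (k : R)) k =
      (fwdDiff 1)^[p.natDegree] p.eval (k : R) := by
    rw [fwdDiff_iter_eq_sum_shift, fwdDiff_iter_eq_sum_shift]
    simp
  rw [hcast, Polynomial.fwdDiff_iter_degree_eq_factorial, Pi.smul_apply, smul_eq_mul]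
  rfl

theorem fwdDiff_iter_choose_mul_choose {K : Type*} [Field K] [CharZero K] (m n a b k : ℕ) :
    (fwdDiff 1)^[m + n] (fun k : ℕ => ((k + a).choose m : K) * (k + b).choose n) k =
      (m + n).choose m := by
  let p := (descPochhammer K m).comp (Polynomial.X + Polynomial.C (a : K)) *
    (descPochhammer K n).comp (Polynomial.X + Polynomial.C (b : K))
  have hmonic : p.Monic := ((monic_descPochhammer K m).comp_X_add_C _).mul
    ((monic_descPochhammer K n).comp_X_add_C _)
  have hdeg : p.natDegree = m + n := by
    rw [((monic_descPochhammer K m).comp_X_add_C _).natDegree_mul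
      ((monic_descPochhammer K n).comp_X_add_C _)]
    simp only [Polynomial.natDegree_comp, Polynomial.natDegree_X_add_C, mul_one,
      descPochhammer_natDegree]
  have heval : (fun k : ℕ => ((k + a).choose m : K) * (k + b).choose n) =
      ((m.factorial : K) * n.factorial)⁻¹ • fun k : ℕ => p.eval (k : K) := by
    ext k
    simp only [Nat.cast_choose_eq_descPochhammer_div, Pi.smul_apply, p, Polynomial.eval_mul,
      Polynomial.eval_comp, Polynomial.eval_add, Polynomial.eval_X, Polynomial.eval_C,
      Nat.cast_add, smul_eq_mul]
    ring
  rw [heval, fwdDiff_iter_const_smul, Pi.smul_apply, ← hdeg, fwdDiff_iter_eval_natCast,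
    hmonic.leadingCoeff, hdeg, Nat.cast_add_choose, one_mul, smul_eq_mul, inv_mul_eq_div]

theorem catalan_eq_choose_div (K : Type*) [Field K] [CharZero K] (m : ℕ) :
    (catalan m : K) = (2 * m).choose m / (m + 1) := by
  rw [← Nat.centralBinom_eq_two_mul_choose, ← succ_mul_catalan_eq_centralBinom, Nat.cast_mul,
    Nat.cast_succ, mul_div_cancel_left₀ _ (Nat.cast_add_one_ne_zero m)]

theorem eval_one_narayana_succ (m : ℕ) : (narayana (m + 1)).eval 1 = catalan (m + 1) := by
  have hterm (i : ℕ) : (1 / ((i + 1 : ℕ) : ℂ)) * (m.choose i : ℂ) * ((m + 1).choose i : ℂ) =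
      ((m + 2).choose (i + 1) * m.choose i : ℕ) / ((m + 1 : ℕ) + 1 : ℂ) := by
    have habsorb : ((m + 1 : ℕ) + 1 : ℂ) * (m + 1).choose i =
        (m + 2).choose (i + 1) * (i + 1 : ℕ) := by
      exact_mod_cast Nat.add_one_mul_choose_eq (m + 1) i
    rw [eq_div_iff (Nat.cast_add_one_ne_zero (m + 1)), Nat.cast_mul]
    field_simp
    linear_combination (m.choose i : ℂ) * habsorb
  have hvandermonde : ∑ i ∈ Finset.range (m + 1), (m + 2).choose (i + 1) * m.choose i =
      (2 * (m + 1)).choose (m + 1) := by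
    rw [show 2 * (m + 1) = m + 2 + m by ring, Nat.add_choose_eq,
      Finset.Nat.sum_antidiagonal_succ, Nat.choose_succ_self, mul_zero, zero_add,
      Finset.Nat.sum_antidiagonal_eq_sum_range_succ_mk]
    refine Finset.sum_congr rfl fun i hi => ?_
    rw [Nat.choose_symm (Nat.lt_succ_iff.1 (Finset.mem_range.1 hi))]
  rw [catalan_eq_choose_div, ← hvandermonde, Nat.cast_sum, Finset.sum_div, narayana,
    Polynomial.eval_finsetSum, ← Finset.Ico_add_one_right_eq_Icc, Finset.sum_Ico_eq_sum_range,
    Nat.add_sub_cancel]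
  refine Finset.sum_congr rfl fun i _ => ?_
  rw [← hterm, Polynomial.eval_C_mul, Polynomial.eval_pow, Polynomial.eval_X, one_pow, mul_one,
    Nat.add_sub_cancel, Nat.add_sub_cancel_left, Nat.add_comm 1 i]

end Numerics

section Degrees

theorem hasDegree_invariantsPiece (m : ℕ) :
    HasDegree (invariantsPiece (m + 2)) (catalan m / 2 ^ (2 * m + 1)) := by
  have hequiv (j : ℕ) := nonempty_invariantsPiece_linearEquiv (m + 2) j
  have hfinite (j : ℕ) : Module.Finite ℂ (invariantsPiece (m + 2) j) :=
    have := finite_invariantSpace (K := ℂ) (finite_setOf_sum_eq (Fin (m + 2)) j)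
    Module.Finite.equiv (hequiv j).some.symm
  have htrdeg : Algebra.trdeg ℂ (jointInvariants (m + 2)) = (2 * m + 1 : ℕ) := by
    rw [jointInvariants_eq_polarInvariants, trdeg_polarInvariants (by simp), Fintype.card_fin]
    congr 1
  have heven : (fun k => (Module.finrank ℂ (invariantsPiece (m + 2) (2 * k)) : ℂ)) =
      (m + 1 : ℂ)⁻¹ • fun k => ((k + m).choose m : ℂ) * (k + (m + 1)).choose m := by
    ext k
    rw [Pi.smul_apply, smul_eq_mul, eq_inv_mul_iff_mul_eq₀ (Nat.cast_add_one_ne_zero m),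
      (hequiv _).some.finrank_eq]
    exact_mod_cast succ_mul_finrank_invariantSpace_two_mul ℂ (Fintype.card_fin (m + 2)) k
  have hodd (k : ℕ) : Module.finrank ℂ (invariantsPiece (m + 2) (2 * k + 1)) = 0 := by
    rw [(hequiv _).some.finrank_eq, finrank_invariantSpace_two_mul_add_one]
  have hdiff (r : ℕ) (hr : r < 2) (k : ℕ) :
      (fwdDiff 1)^[2 * m]
        (fun l => (Module.finrank ℂ (invariantsPiece (m + 2) (2 * l + r)) : ℂ)) k =
        if r = 0 then (catalan m : ℂ) else 0 := by
    interval_cases r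
    · change (fwdDiff 1)^[2 * m]
        (fun l => (Module.finrank ℂ (invariantsPiece (m + 2) (2 * l)) : ℂ)) k = _
      rw [heven, fwdDiff_iter_const_smul, Pi.smul_apply, two_mul, fwdDiff_iter_choose_mul_choose,
        if_pos rfl, catalan_eq_choose_div, two_mul, smul_eq_mul, inv_mul_eq_div]
    · simp [hodd, fwdDiff_iter_eq_sum_shift]
  convert hasDegree_of_fwdDiff_iter_finrank hfinite htrdeg two_ne_zero _ hdiff using 1
  simp

theorem hasDegree_covariantsPiece (m : ℕ) :
    HasDegree (covariantsPiece (m + 1)) (m.centralBinom / 2 ^ (2 * m)) := by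
  have hequiv (j : ℕ) := nonempty_covariantsPiece_linearEquiv (m + 1) j
  have hfinite (j : ℕ) : Module.Finite ℂ (covariantsPiece (m + 1) j) := by
    have := finite_invariantSpace (K := ℂ) (finite_boundedOrder (Fin (m + 1)) j j)
    rw [← invariantSpace_setOf_sum_some_eq] at this
    exact Module.Finite.equiv (hequiv j).some.symm
  have htrdeg : Algebra.trdeg ℂ (jointCovariants (m + 1)) = (2 * m + 1 : ℕ) :=
    trdeg_jointCovariants m.succ_pos
  have hfinrank (j : ℕ) : Module.finrank ℂ (covariantsPiece (m + 1) j) =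
      (j / 2 + m).choose m * (j - j / 2 + m).choose m := by
    rw [(hequiv j).some.finrank_eq, invariantSpace_setOf_sum_some_eq,
      finrank_invariantSpace_boundedOrder ℂ _ le_rfl, Fintype.card_fin, multichoose_succ_left,
      multichoose_succ_left, Nat.add_comm m, Nat.add_comm m]
  have hdiff (r : ℕ) (hr : r < 2) (k : ℕ) :
      (fwdDiff 1)^[2 * m]
        (fun l => (Module.finrank ℂ (covariantsPiece (m + 1) (2 * l + r)) : ℂ)) k =
        m.centralBinom := by
    have hsplit (l : ℕ) : Module.finrank ℂ (covariantsPiece (m + 1) (2 * l + r)) =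
        (l + m).choose m * (l + (r + m)).choose m := by
      rw [hfinrank, show (2 * l + r) / 2 = l by omega, show 2 * l + r - l = l + r by omega,
        Nat.add_assoc l r m]
    simp only [hsplit, Nat.cast_mul]
    rw [two_mul, fwdDiff_iter_choose_mul_choose, Nat.centralBinom, two_mul]
  convert hasDegree_of_fwdDiff_iter_finrank hfinite htrdeg two_ne_zero _ hdiff using 1
  rw [Finset.sum_const, Finset.card_range, nsmul_eq_mul, pow_succ']
  exact (mul_div_mul_left _ _ two_ne_zero).symm

end Degrees

theorem theorem3 (n : ℕ) :
    (2 ≤ n → HasDegree (invariantsPiece n)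
      (((2 * n - 4).choose (n - 2) : ℂ) / (((n : ℂ) - 1) * 2 ^ (2 * n - 3)))) ∧
    (3 ≤ n →
      HasDegree (invariantsPiece n) ((narayana (n - 2)).eval 1 / 2 ^ (2 * n - 3)) ∧
      (narayana (n - 2)).eval 1 / 2 ^ (2 * n - 3) =
        ((2 * n - 4).choose (n - 2) : ℂ) / (((n : ℂ) - 1) * 2 ^ (2 * n - 3))) ∧
    (1 ≤ n → HasDegree (covariantsPiece n)
      (((2 * n - 2).choose (n - 1) : ℂ) / 2 ^ (2 * n - 2))) := by
  have hcatalan (m : ℕ) : ((2 * (m + 2) - 4).choose m : ℂ) /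
      ((((m + 2 : ℕ) : ℂ) - 1) * 2 ^ (2 * (m + 2) - 3)) = catalan m / 2 ^ (2 * m + 1) := by
    rw [catalan_eq_choose_div, div_div, show 2 * (m + 2) - 4 = 2 * m by omega,
      show 2 * (m + 2) - 3 = 2 * m + 1 by omega]
    push_cast
    ring
  have hnarayana (m : ℕ) : (narayana (m + 1)).eval 1 / 2 ^ (2 * (m + 3) - 3) =
      (catalan (m + 1) : ℂ) / 2 ^ (2 * (m + 1) + 1) := by
    rw [eval_one_narayana_succ, show 2 * (m + 3) - 3 = 2 * (m + 1) + 1 by omega]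
  refine ⟨fun hn => ?_, fun hn => ?_, fun hn => ?_⟩
  · obtain ⟨m, rfl⟩ := Nat.exists_eq_add_of_le' hn
    exact (hcatalan m).symm ▸ hasDegree_invariantsPiece m
  · obtain ⟨m, rfl⟩ := Nat.exists_eq_add_of_le' hn
    exact ⟨(hnarayana m).symm ▸ hasDegree_invariantsPiece (m + 1),
      (hnarayana m).trans (hcatalan (m + 1)).symm⟩
  · obtain ⟨m, rfl⟩ := Nat.exists_eq_add_of_le' hn
    exact hasDegree_covariantsPiece m
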